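/- Let $q$ be a complex number with $0<|q|<1$. Write $(w;q)_n=\prod_{i=0}^{n-1}(1-wq^i)$, $(w;q)_\infty=\prod_{i\ge 0}(1-wq^i)$, $(w)_n=(w;q)_n$ and $(w)_\infty=(w;q)_\infty$. For real $x$ with $-1\le x\le 1$ let $$A_n(q,q,x)=\frac{(-1)^n(1-q^{2n+1})\,q^{n(3n+1)/2}\,x^n(q/x)_n}{(1-q)(xq)_n}\left(1+\sum_{j=1}^{n}\frac{(q)_{j-1}(1-q^{2j})(x)_j\,q^{-j^2}x^{-j}}{(q)_j(q/x)_j}\right),$$ extended by continuity to $x=0$ and $x=q^i$; that is, $x^n(q/x)_n$ is multiplied into the bracket and $\frac{x^n(q/x)_n}{x^j(q/x)_j}$ is read as $\prod_{i=j+1}^{n}(x-q^i)$. (Together with $1/(xq)_n$ this is Andrews' Bailey pair relative to $(q,q)$.) Then all the series below converge absolutely, in the double sums the inner series over $k$ for every $n\ge 0$ and then the outer series over $n$, and the following identities hold. 1. For every real $x$ with $-1\le x\le 1$, $$\frac12\frac{(-x)_\infty}{(-q)_\infty}\sum_{n\ge0}\frac{q^{n(n+1)}}{(-q)_n(xq)_n}+\frac{1-x}{2}\sum_{n\ge0}\frac{(-1)^nq^{n(n+1)}}{(q^2;q^2)_n}\sum_{k\ge0}\frac{(-x)_k}{(-q)_k}q^{(n+1)k}$$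 $$=\frac1{(q^2;q)_\infty}\sum_{n\ge0}q^{n(n+1)/2}A_n(q,q,x)=\frac1{(-q)_\infty}\sum_{n\ge0}\frac{(-q)_n}{(xq)_n}q^{n(n+1)/2}.$$ 2. (The case $x=0$ of 1.) $$\frac1{2(-q)_\infty}\sum_{n\ge0}\frac{q^{n(n+1)}}{(-q)_n}+\frac12\sum_{n\ge0}\frac{q^n(q^{n+2};q^2)_\infty}{(-q)_n}=\frac1{(-q)_\infty}\sum_{n\ge0}(-q)_nq^{n(n+1)/2}.$$ 3. (The case $x=-q^{1/2}$ of 1, with $q$ replaced by $q^2$.) $$\frac12\frac{(q;q^2)_\infty}{(-q^2;q^2)_\infty}\sum_{n\ge0}\frac{q^{2n(n+1)}}{(-q)_{2n+1}}+\frac12\sum_{n\ge0}\frac{(-1)^nq^{2n(n+1)}}{(q^4;q^4)_n}\sum_{k\ge0}\frac{(q;q^2)_k}{(-q^2;q^2)_k}q^{2(n+1)k}=\frac1{(-q^2;q^2)_\infty}\sum_{n\ge0}\frac{(-q^2;q^2)_n}{(-q;q^2)_{n+1}}q^{n(n+1)}.$$ 4. For either choice of the square root $q^{1/2}$ (half-integral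 powers of $q$ are powers of this $q^{1/2}$) and every real $x$ with $-1\le x\le 1$, $$\frac{(-xq^{1/2})_\infty}{(-q^{1/2})_\infty}\sum_{n\ge0}\frac{q^{n(n+1)}}{(-q^{1/2})_{n+1}(xq)_n}+q^{1/2}\sum_{n\ge0}\frac{(x)_{n+1}}{(-q^{1/2})_{n+1}(q)_n(xq)_n}(-1)^nq^{n(n+3/2)}\sum_{k\ge0}\frac{(-xq^{1/2})_k}{(-q^{1/2})_{k+1}}q^{(n+1)k}$$ $$=\frac1{(q^2;q)_\infty}\sum_{n\ge0}\frac{q^{n^2/2+n}A_n(q,q,x)}{1+q^{n+1/2}}=\frac1{(-q^{1/2})_\infty}\sum_{n\ge0}\frac{(-q^{1/2})_n}{(xq)_n}q^{n(n+2)/2}.$$ 5. (The case $x=0$ of 4, with $q$ replaced by $q^2$.) $$\frac1{(-q;q^2)_\infty}\sum_{n\ge0}\frac{q^{2n(n+1)}}{(-q;q^2)_{n+1}}+q\sum_{n\ge0}\frac{(-1)^nq^{n(2n+3)}}{(-q;q^2)_{n+1}(q^2;q^2)_n}\sum_{k\ge0}\frac{q^{2(n+1)k}}{(-q;q^2)_{k+1}}=\frac1{(-q;q^2)_\infty}\sum_{n\ge0}(-q;q^2)_nq^{n(n+2)}.$$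 6. (The case $x=-1$ of 4, with $q$ replaced by $q^2$.) $$\frac{(q;q^2)_\infty}{(-q;q^2)_\infty}\sum_{n\ge0}\frac{q^{2n(n+1)}}{(-q)_{2n+1}}+2q\sum_{n\ge0}\frac{(-1)^nq^{n(2n+3)}}{(-q;q^2)_{n+1}(q^2;q^2)_n}\sum_{k\ge0}\frac{(q;q^2)_k}{(-q;q^2)_{k+1}}q^{2(n+1)k}=\frac1{(-q;q^2)_\infty}\sum_{n\ge0}\frac{(-q;q^2)_n}{(-q^2;q^2)_n}q^{n(n+2)}.$$ 7. (The case $x=-q^{1/2}$ of 4, with $q$ replaced by $q^2$.) $$\frac{(q^2;q^2)_\infty}{(-q;q^2)_\infty}\sum_{n\ge0}\frac{q^{2n(n+1)}}{(-q;q^2)_{n+1}^2}+q\sum_{n\ge0}\frac{(-1)^nq^{n(2n+3)}}{(-q;q^2)_{n+1}(q^2;q^2)_n}\sum_{k\ge0}\frac{(q^2;q^2)_k}{(-q;q^2)_{k+1}}q^{2(n+1)k}=\frac1{(-q;q^2)_\infty}\sum_{n\ge0}\frac{q^{n(n+2)}}{1+q^{2n+1}}.$$ -/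

import Mathlib

open Finset

noncomputable section

/-- The finite `q`-shifted factorial `(w; q)_n = (1 - w) (1 - w q) ⋯ (1 - w q ^ (n - 1))`. -/
def qPoch (w q : ℂ) (n : ℕ) : ℂ := ∏ i ∈ range n, (1 - w * q ^ i)

/-- The infinite product `(w; q)_∞ = ∏_{i ≥ 0} (1 - w q ^ i)`. -/
def qPochInf (w q : ℂ) : ℂ := ∏' i : ℕ, (1 - w * q ^ i)

/-- For `|q| < 1` the product defining `(w; q)_∞` converges. -/
theorem multipliable_qPochInf (w : ℂ) {q : ℂ} (hq : ‖q‖ < 1) :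
    Multipliable fun i : ℕ => 1 - w * q ^ i := by
  have h : Summable fun i : ℕ => ‖-(w * q ^ i)‖ := by
    simpa [norm_mul, norm_pow] using
      (summable_geometric_of_lt_one (norm_nonneg q) hq).mul_left ‖w‖
  simpa [sub_eq_add_neg] using multipliable_one_add_of_summable h

/-- Andrews' sequence `A_n(aq, q, b)`. With respect to the base `(aq, q)` it forms a Bailey pair
together with `B_n(aq, q, b) = 1 / (bq; q)_n`. For generic `b` it is the product of
`(-1)^n (1 - a q^(2n+1)) a^n q^(n(3n+1)/2) b^n (aq/b)_n / ((1 - aq) (bq)_n)` and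
`1 + ∑_{1 ≤ j ≤ n} (aq)_(j-1) (1 - a q^(2j)) (b)_j a^(-j) q^(-j^2) b^(-j) / ((q)_j (aq/b)_j)`;
see `andrewsA_eq`. Here the factor `b^n (aq/b)_n` is multiplied into the second factor, and
`b^n (aq/b)_n / (b^j (aq/b)_j)` is written as the product of `b - a q^i` over `j < i ≤ n`; this
is the continuous extension of the formula to `b = 0` and `b = a q^i`.
In particular `A_n(q, q, b)` is `andrewsA 1 q b n`. -/
def andrewsA (a q b : ℂ) (n : ℕ) : ℂ :=
  (-1) ^ n * (1 - a * q ^ (2 * n + 1)) * a ^ n * q ^ (n * (3 * n + 1) / 2) /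
      ((1 - a * q) * qPoch (b * q) q n) *
    (∏ i ∈ Ioc 0 n, (b - a * q ^ i) +
      ∑ j ∈ Icc 1 n,
        qPoch (a * q) q (j - 1) * (1 - a * q ^ (2 * j)) * qPoch b q j /
            (qPoch q q j * a ^ j * q ^ (j ^ 2)) *
          ∏ i ∈ Ioc j n, (b - a * q ^ i))

theorem pow_mul_qPoch_eq (a q : ℂ) {b : ℂ} (hb : b ≠ 0) (n : ℕ) :
    b ^ n * qPoch (a * q / b) q n = ∏ i ∈ Ioc 0 n, (b - a * q ^ i) := by
  induction n with
  | zero => simp [qPoch]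
  | succ n ih =>
    have hs : qPoch (a * q / b) q (n + 1)
        = qPoch (a * q / b) q n * (1 - a * q / b * q ^ n) := by
      simp [qPoch, prod_range_succ]
    rw [prod_Ioc_succ_top (Nat.zero_le n), ← ih, hs]
    field_simp
    ring

/-- For generic `b`, `andrewsA` is the quotient formula for `A_n(aq, q, b)`. -/
theorem andrewsA_eq (a q : ℂ) {b : ℂ} (hb : b ≠ 0) (hab : ∀ i : ℕ, b ≠ a * q ^ i) (n : ℕ) :
    andrewsA a q b n =
      (-1) ^ n * (1 - a * q ^ (2 * n + 1)) * a ^ n * q ^ (n * (3 * n + 1) / 2) *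
          b ^ n * qPoch (a * q / b) q n / ((1 - a * q) * qPoch (b * q) q n) *
        (1 + ∑ j ∈ Icc 1 n,
          qPoch (a * q) q (j - 1) * (1 - a * q ^ (2 * j)) * qPoch b q j *
              (a ^ j)⁻¹ * (q ^ (j ^ 2))⁻¹ * (b ^ j)⁻¹ /
            (qPoch q q j * qPoch (a * q / b) q j)) := by
  have key : ∀ j ∈ Icc 1 n, ∏ i ∈ Ioc j n, (b - a * q ^ i)
      = b ^ n * qPoch (a * q / b) q n * ((b ^ j)⁻¹ * (qPoch (a * q / b) q j)⁻¹) := by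
    intro j hj
    have hjn : j ≤ n := (mem_Icc.1 hj).2
    have h0 : ∏ i ∈ Ioc 0 j, (b - a * q ^ i) ≠ 0 :=
      prod_ne_zero_iff.2 fun i _ => sub_ne_zero.2 (hab i)
    rw [← mul_inv, pow_mul_qPoch_eq a q hb n, pow_mul_qPoch_eq a q hb j,
      ← prod_Ioc_consecutive _ (Nat.zero_le j) hjn]
    field_simp
  unfold andrewsA
  rw [sum_congr rfl fun j hj => by rw [key j hj], ← pow_mul_qPoch_eq a q hb n]
  have : ∀ C D E : ℂ, ∀ f g : ℕ → ℂ, (∀ j ∈ Icc 1 n, f j = D * g j) →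
      C / E * (D + ∑ j ∈ Icc 1 n, f j) = C * D / E * (1 + ∑ j ∈ Icc 1 n, g j) := by
    intro C D E f g h
    rw [sum_congr rfl h, ← mul_sum]
    ring
  rw [mul_assoc _ (b ^ n)]
  apply this
  intro j _
  simp only [div_eq_mul_inv, mul_inv]
  ring

end

/-! ### Finite and infinite `q`-shifted factorials -/

/-! The identities all come from two evaluations of L(y) = ∑ (y + q)⋯(y + q^n) q^(n(n+1)/2) /
(xq)_n, for complex |x| ≤ 1, |y| ≤ 1 and y ≠ 0, -1. Here (y + q)⋯(y + q^n) = y^n (-q/y)_n, so y = 1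
produces (-q)_n and y = q^(1/2) produces q^(n/2) (-q^(1/2))_n. The first choice gives the first
three identities and the second gives the other four; within each group one specialises x.

Bailey side (`tsum_andrewsA_eq`): replace 1/(xq)_n by its expansion in Andrews' sequence
(`sum_andrewsA_eq`) and interchange the sums. The inner sum is a ₁φ₁ series, summed by
`tsum_one_phi_one`, the limit of the finite q-Vandermonde sum.

Double-series side (`tsum_shiftedProd_eq_double`): let S_j(z) be the j-th partial sum of ∑ (x)_i
(-z)^i / (q)_i. The expansion `prod_add_pow_div_qPoch` and Euler's formula give L(y) = G(y), where
G(z) = ∑ q^(j(j+1)) (-y q^(j+1))_∞ S_j(z) / (xq)_j and y is held fixed. The full binomial series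
satisfies (1 + z) S(z) = (1 + xz) S(zq); truncation leaves one boundary term, so (1 + z) G(z) - (1 +
xz) G(zq) is an explicit single series (`telescopeFun_functional`). Iterating along z = y q^k, with
weights (-xy)_k / (-y)_k, telescopes: the differences add up to the double series, and the limit
G(0) supplies the single series.

Both finite expansions are proved by creative telescoping: a closed form for a weighted partial sum
vanishes at its last index, which yields a first-order recurrence in n. All interchanges and limits
rest on geometric bounds with constants built from `qBound`. -/

theorem qPoch_zero (w q : ℂ) : qPoch w q 0 = 1 := by simp [qPoch]

theorem qPoch_succ (w q : ℂ) (n : ℕ) : qPoch w q (n + 1) = qPoch w q n * (1 - w * q ^ n) := by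
  simp [qPoch, prod_range_succ]

theorem qPoch_add (w q : ℂ) (m n : ℕ) :
    qPoch w q (m + n) = qPoch w q m * qPoch (w * q ^ m) q n := by
  simp [qPoch, prod_range_add, pow_add, mul_assoc]

theorem qPoch_succ' (w q : ℂ) (n : ℕ) : qPoch w q (n + 1) = (1 - w) * qPoch (w * q) q n := by
  rw [add_comm, qPoch_add, qPoch_succ, qPoch_zero]
  simp

theorem qPoch_one (w q : ℂ) : qPoch w q 1 = 1 - w := by simp [qPoch]

theorem qPoch_zero_left (q : ℂ) (n : ℕ) : qPoch 0 q n = 1 := by simp [qPoch]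

theorem tendsto_qPoch (w : ℂ) {q : ℂ} (hq : ‖q‖ < 1) :
    Filter.Tendsto (qPoch w q) Filter.atTop (nhds (qPochInf w q)) :=
  (multipliable_qPochInf w hq).hasProd.tendsto_prod_nat

theorem qPochInf_eq_mul (w : ℂ) {q : ℂ} (hq : ‖q‖ < 1) (n : ℕ) :
    qPochInf w q = qPoch w q n * qPochInf (w * q ^ n) q := by
  have h1 := (tendsto_qPoch (w * q ^ n) hq).const_mul (qPoch w q n)
  have h2 := (Filter.tendsto_add_atTop_iff_nat n).2 (tendsto_qPoch w hq)
  refine tendsto_nhds_unique h2 (h1.congr fun m => ?_)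
  rw [add_comm m n, qPoch_add]

/-! ### Bounds uniform in the length of the product, and non-vanishing -/

theorem prod_one_add_le_exp {r K : ℝ} (hr0 : 0 ≤ r) (hr1 : r < 1) (hK : 0 ≤ K) (n : ℕ) :
    ∏ i ∈ range n, (1 + K * r ^ i) ≤ Real.exp (K / (1 - r)) := by
  have hs : ∑ i ∈ range n, r ^ i ≤ (1 - r)⁻¹ := by
    rw [← tsum_geometric_of_lt_one hr0 hr1]
    exact (summable_geometric_of_lt_one hr0 hr1).sum_le_tsum _ fun i _ => by positivity
  calc ∏ i ∈ range n, (1 + K * r ^ i) ≤ ∏ i ∈ range n, Real.exp (K * r ^ i) :=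
        prod_le_prod (fun i _ => by positivity) fun i _ => by
          rw [add_comm]; exact Real.add_one_le_exp _
    _ = Real.exp (K * ∑ i ∈ range n, r ^ i) := by rw [← Real.exp_sum, mul_sum]
    _ ≤ Real.exp (K / (1 - r)) := by
        rw [div_eq_mul_inv]
        exact Real.exp_le_exp.2 (mul_le_mul_of_nonneg_left hs hK)

theorem norm_qPoch_le_exp (w : ℂ) {q : ℂ} (hq : ‖q‖ < 1) (n : ℕ) :
    ‖qPoch w q n‖ ≤ Real.exp (‖w‖ / (1 - ‖q‖)) := by
  refine le_trans ?_ (prod_one_add_le_exp (norm_nonneg q) hq (norm_nonneg w) n)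
  rw [qPoch, norm_prod]
  refine prod_le_prod (fun i _ => norm_nonneg _) fun i _ => ?_
  refine (norm_sub_le _ _).trans ?_
  simp

/-- A common bound for the `q`-shifted factorials `(w; q)_n` with `|w| ≤ 1` and for the
reciprocals of `(w q; q)_n`. -/
noncomputable def qBound (q : ℂ) : ℝ := Real.exp (1 / (1 - ‖q‖) ^ 2)

theorem qBound_pos (q : ℂ) : 0 < qBound q := Real.exp_pos _

theorem qBound_nonneg (q : ℂ) : 0 ≤ qBound q := (qBound_pos q).le

theorem norm_prod_range_le_qBound {q : ℂ} (hq : ‖q‖ < 1) (f : ℕ → ℂ)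
    (hf : ∀ i, ‖f i‖ ≤ 1 + ‖q‖ ^ i) (n : ℕ) : ‖∏ i ∈ range n, f i‖ ≤ qBound q := by
  have h1 : 0 < 1 - ‖q‖ := sub_pos.2 hq
  calc ‖∏ i ∈ range n, f i‖ ≤ ∏ i ∈ range n, (1 + 1 * ‖q‖ ^ i) := by
        rw [norm_prod]
        exact prod_le_prod (fun i _ => norm_nonneg _) fun i _ => by simpa using hf i
    _ ≤ Real.exp (1 / (1 - ‖q‖)) := prod_one_add_le_exp (norm_nonneg q) hq zero_le_one n
    _ ≤ qBound q := by
        refine Real.exp_le_exp.2 (one_div_le_one_div_of_le (by positivity) ?_)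
        nlinarith [norm_nonneg q]

theorem norm_qPoch_le {w q : ℂ} (hq : ‖q‖ < 1) (hw : ‖w‖ ≤ 1) (n : ℕ) :
    ‖qPoch w q n‖ ≤ qBound q := by
  refine norm_prod_range_le_qBound hq _ (fun i => ?_) n
  refine (norm_sub_le _ _).trans ?_
  rw [norm_one, norm_mul, norm_pow]
  gcongr
  exact mul_le_of_le_one_left (by positivity) hw

theorem norm_qPochInf_le {w q : ℂ} (hq : ‖q‖ < 1) (hw : ‖w‖ ≤ 1) :
    ‖qPochInf w q‖ ≤ qBound q :=
  le_of_tendsto (tendsto_qPoch w hq).norm (Filter.Eventually.of_forall (norm_qPoch_le hq hw))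

theorem one_sub_mul_pow_ne_zero {w q : ℂ} (hq : ‖q‖ < 1) (hw : ‖w‖ ≤ 1) {n : ℕ} (hn : n ≠ 0) :
    1 - w * q ^ n ≠ 0 := by
  intro h
  have h1 : ‖w * q ^ n‖ = 1 := by rw [← sub_eq_zero.1 h, norm_one]
  have h2 : ‖w * q ^ n‖ < 1 := by
    rw [norm_mul, norm_pow]
    exact (mul_le_of_le_one_left (by positivity) hw).trans_lt
      (pow_lt_one₀ (norm_nonneg q) hq hn)
  exact h2.ne h1

theorem one_sub_pow_ne_zero {q : ℂ} (hq : ‖q‖ < 1) {n : ℕ} (hn : n ≠ 0) : 1 - q ^ n ≠ 0 := by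
  simpa using one_sub_mul_pow_ne_zero (w := 1) hq (by simp) hn

theorem qPoch_mul_ne_zero {w q : ℂ} (hq : ‖q‖ < 1) (hw : ‖w‖ ≤ 1) (n : ℕ) :
    qPoch (w * q) q n ≠ 0 := by
  refine prod_ne_zero_iff.2 fun i _ => ?_
  rw [mul_assoc, ← pow_succ']
  exact one_sub_mul_pow_ne_zero hq hw (Nat.succ_ne_zero i)

theorem qPoch_self_ne_zero {q : ℂ} (hq : ‖q‖ < 1) (n : ℕ) : qPoch q q n ≠ 0 := by
  simpa using qPoch_mul_ne_zero (w := 1) hq (by simp) n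

/-- Each inverse factor is at most 1 + |q|^i / (1 - |q|), so the product is controlled by a
geometric series with constant 1/(1 - |q|). Summing that series costs a second factor 1/(1 - |q|),
whence the square in `qBound`. -/
theorem norm_inv_qPoch_mul_le {w q : ℂ} (hq : ‖q‖ < 1) (hw : ‖w‖ ≤ 1) (n : ℕ) :
    ‖(qPoch (w * q) q n)⁻¹‖ ≤ qBound q := by
  have h1 : 0 < 1 - ‖q‖ := sub_pos.2 hq
  have key := prod_one_add_le_exp (norm_nonneg q) hq (inv_nonneg.2 h1.le) n
  have e : (1 - ‖q‖)⁻¹ / (1 - ‖q‖) = 1 / (1 - ‖q‖) ^ 2 := by field_simp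
  rw [e] at key
  refine le_trans ?_ key
  rw [qPoch, ← prod_inv_distrib, norm_prod]
  refine prod_le_prod (fun i _ => norm_nonneg _) fun i _ => ?_
  have hs : ‖q‖ ^ (i + 1) ≤ ‖q‖ := pow_le_of_le_one (norm_nonneg q) hq.le (Nat.succ_ne_zero i)
  have hs' : ‖q‖ ^ (i + 1) ≤ ‖q‖ ^ i := pow_le_pow_of_le_one (norm_nonneg q) hq.le (Nat.le_succ i)
  have hlow : 1 - ‖q‖ ^ (i + 1) ≤ ‖1 - w * q * q ^ i‖ := by
    have := norm_sub_norm_le (1 : ℂ) (w * q * q ^ i)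
    rw [norm_one, mul_assoc, ← pow_succ', norm_mul, norm_pow] at this
    rw [mul_assoc, ← pow_succ']
    have h2 : ‖w‖ * ‖q‖ ^ (i + 1) ≤ ‖q‖ ^ (i + 1) := mul_le_of_le_one_left (by positivity) hw
    linarith
  have h3 : 0 < 1 - ‖q‖ ^ (i + 1) := by linarith
  rw [norm_inv]
  calc ‖1 - w * q * q ^ i‖⁻¹ ≤ (1 - ‖q‖ ^ (i + 1))⁻¹ := inv_anti₀ h3 hlow
    _ = 1 + ‖q‖ ^ (i + 1) / (1 - ‖q‖ ^ (i + 1)) := by field_simp; ring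
    _ ≤ 1 + ‖q‖ ^ i / (1 - ‖q‖) := by gcongr
    _ = 1 + (1 - ‖q‖)⁻¹ * ‖q‖ ^ i := by ring

theorem norm_inv_qPoch_self_le {q : ℂ} (hq : ‖q‖ < 1) (n : ℕ) :
    ‖(qPoch q q n)⁻¹‖ ≤ qBound q := by
  simpa using norm_inv_qPoch_mul_le (w := 1) hq (by simp) n

/-- The bound on the inverses keeps the finite products away from zero uniformly, so their limit is
nonzero as well. -/
theorem qPochInf_mul_ne_zero {w q : ℂ} (hq : ‖q‖ < 1) (hw : ‖w‖ ≤ 1) :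
    qPochInf (w * q) q ≠ 0 := by
  have h : (qBound q)⁻¹ ≤ ‖qPochInf (w * q) q‖ := by
    refine ge_of_tendsto (tendsto_qPoch (w * q) hq).norm (Filter.Eventually.of_forall fun n => ?_)
    have h1 := norm_inv_qPoch_mul_le hq hw n
    rw [norm_inv] at h1
    exact inv_le_of_inv_le₀ (norm_pos_iff.2 (qPoch_mul_ne_zero hq hw n)) h1
  exact norm_pos_iff.1 ((inv_pos.2 (qBound_pos q)).trans_le h)

theorem qPochInf_self_ne_zero {q : ℂ} (hq : ‖q‖ < 1) : qPochInf q q ≠ 0 := by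
  simpa using qPochInf_mul_ne_zero (w := 1) hq (by simp)

theorem qPoch_neg_ne_zero {y q : ℂ} (hq : ‖q‖ < 1) (hy : ‖y‖ ≤ 1) (hy1 : 1 + y ≠ 0) (n : ℕ) :
    qPoch (-y) q n ≠ 0 := by
  cases n with
  | zero => simp [qPoch_zero]
  | succ n =>
    rw [qPoch_succ', sub_neg_eq_add]
    exact mul_ne_zero hy1 (qPoch_mul_ne_zero hq (by simpa using hy) n)

/-- The first factor 1 + y is the only one not bounded below in terms of |q|, so it is split off. If
1 + y = 0 both sides are zero, by the convention for inverses. -/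
theorem norm_inv_qPoch_neg_succ_le {y q : ℂ} (hq : ‖q‖ < 1) (hy : ‖y‖ ≤ 1) (n : ℕ) :
    ‖(qPoch (-y) q (n + 1))⁻¹‖ ≤ ‖(1 + y)⁻¹‖ * qBound q := by
  rw [qPoch_succ', sub_neg_eq_add, mul_inv, norm_mul]
  gcongr
  exact norm_inv_qPoch_mul_le hq (by simpa using hy) n

theorem qPochInf_neg_ne_zero {y q : ℂ} (hq : ‖q‖ < 1) (hy : ‖y‖ ≤ 1) (hy1 : 1 + y ≠ 0) :
    qPochInf (-y) q ≠ 0 := by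
  rw [qPochInf_eq_mul _ hq 1, qPoch_one, sub_neg_eq_add, pow_one]
  exact mul_ne_zero hy1 (qPochInf_mul_ne_zero hq (by simpa using hy))

theorem norm_mul_pow_le_one {w q : ℂ} (hq : ‖q‖ < 1) (hw : ‖w‖ ≤ 1) (n : ℕ) :
    ‖w * q ^ n‖ ≤ 1 := by
  rw [norm_mul, norm_pow]
  exact mul_le_one₀ hw (by positivity) (pow_le_one₀ (norm_nonneg q) hq.le)

/-! ### Triangular exponents -/

theorem triangle_succ (n : ℕ) : (n + 1) * (n + 1 + 1) / 2 = n * (n + 1) / 2 + (n + 1) := by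
  rw [show (n + 1) * (n + 1 + 1) = n * (n + 1) + 2 * (n + 1) by ring,
    Nat.add_mul_div_left _ _ two_pos]

theorem le_triangle (n : ℕ) : n ≤ n * (n + 1) / 2 := by
  induction n with
  | zero => simp
  | succ n ih => rw [triangle_succ]; omega

theorem triangle_add_triangle (n : ℕ) : n * (n + 1) / 2 + n * (n + 1) / 2 = n * (n + 1) := by
  have := Nat.div_mul_cancel (Nat.even_mul_succ_self n).two_dvd
  omega

theorem triangle_add (m n : ℕ) :
    (m + n) * (m + n + 1) / 2 = m * (m + 1) / 2 + n * (n + 1) / 2 + m * n := by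
  have h1 := triangle_add_triangle (m + n)
  have h2 := triangle_add_triangle m
  have h3 := triangle_add_triangle n
  nlinarith

theorem triangle_eq_choose_add (n : ℕ) : n * (n + 1) / 2 = n.choose 2 + n := by
  induction n with
  | zero => simp
  | succ n ih =>
    rw [triangle_succ, ih, Nat.choose_succ_succ' n 1, Nat.choose_one_right]
    ring

/-- Isolates the power q^(n^2), which compensates the negative powers q^(-j^2) in Andrews' sum. -/
theorem pentagonal_eq (n : ℕ) : n * (3 * n + 1) / 2 = n * (n + 1) / 2 + n ^ 2 := by
  rw [show n * (3 * n + 1) = n * (n + 1) + 2 * n ^ 2 by ring, Nat.add_mul_div_left _ _ two_pos]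

/-! ### Summation tools -/

theorem summable_of_norm_le_geometric {f : ℕ → ℂ} {r C : ℝ} (hr0 : 0 ≤ r) (hr1 : r < 1)
    (h : ∀ n, ‖f n‖ ≤ C * r ^ n) : Summable f :=
  .of_norm_bounded ((summable_geometric_of_lt_one hr0 hr1).mul_left C) h

theorem summable_prod_of_norm_le_geometric {f : ℕ × ℕ → ℂ} {r C : ℝ} (hr0 : 0 ≤ r) (hr1 : r < 1)
    (h : ∀ m n, ‖f (m, n)‖ ≤ C * (r ^ m * r ^ n)) : Summable f := by
  have hg := summable_geometric_of_lt_one hr0 hr1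
  have := (hg.mul_of_nonneg hg (fun n => by positivity) fun n => by positivity).mul_left C
  exact .of_norm_bounded this fun p => h p.1 p.2

/-- Absolute convergence allows summation along antidiagonals; this is how a finite expansion
inserted into a series becomes an iterated series. -/
theorem tsum_sum_range_eq_tsum_tsum {f : ℕ × ℕ → ℂ} (hf : Summable f) :
    ∑' n, ∑ j ∈ range (n + 1), f (j, n - j) = ∑' j, ∑' m, f (j, m) := by
  refine Eq.trans ?_ hf.tsum_prod
  refine Eq.trans ?_ ((Finset.HasAntidiagonal.sigmaAntidiagonalEquivProd (A := ℕ)).tsum_eq f)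
  have hs : Summable fun c => f (Finset.HasAntidiagonal.sigmaAntidiagonalEquivProd (A := ℕ) c) :=
    (Finset.HasAntidiagonal.sigmaAntidiagonalEquivProd (A := ℕ)).summable_iff.2 hf
  rw [hs.tsum_sigma]
  refine tsum_congr fun n => ?_
  rw [tsum_fintype, ← Finset.Nat.sum_antidiagonal_eq_sum_range_succ_mk]
  exact (Finset.sum_coe_sort (antidiagonal n) f).symm

theorem tsum_sub_succ_eq {f : ℕ → ℂ} {a : ℂ} (hf : Filter.Tendsto f Filter.atTop (nhds a))
    (hs : Summable fun n => f n - f (n + 1)) : ∑' n, (f n - f (n + 1)) = f 0 - a := by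
  refine tendsto_nhds_unique hs.hasSum.tendsto_sum_nat ?_
  simp_rw [sum_range_sub']
  exact hf.const_sub _

/-! ### The `q`-Vandermonde sum and its limits -/

/-- The Gaussian binomial coefficients. -/
def gaussBinom (q : ℂ) : ℕ → ℕ → ℂ
  | _, 0 => 1
  | 0, _ + 1 => 0
  | n + 1, k + 1 => gaussBinom q n (k + 1) + q ^ (n - k) * gaussBinom q n k

theorem gaussBinom_zero_right (q : ℂ) (n : ℕ) : gaussBinom q n 0 = 1 := by
  cases n <;> rfl

theorem gaussBinom_succ_succ (q : ℂ) (n k : ℕ) :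
    gaussBinom q (n + 1) (k + 1) = gaussBinom q n (k + 1) + q ^ (n - k) * gaussBinom q n k := rfl

/-- Because of this vanishing, the truncated exponent `n - k` in Pascal's rule is harmless for k >
n, and finite sums may be read as series. -/
theorem gaussBinom_eq_zero (q : ℂ) {n k : ℕ} (h : n < k) : gaussBinom q n k = 0 := by
  induction n generalizing k with
  | zero => obtain ⟨k, rfl⟩ := Nat.exists_eq_add_of_lt h; rfl
  | succ n ih =>
    obtain _ | k := k
    · omega
    · rw [gaussBinom_succ_succ, ih (by omega), ih (by omega), mul_zero, add_zero]

theorem gaussBinom_self (q : ℂ) (n : ℕ) : gaussBinom q n n = 1 := by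
  induction n with
  | zero => rfl
  | succ n ih => simp [gaussBinom_succ_succ, gaussBinom_eq_zero q (Nat.lt_succ_self n), ih]

/-- Pascal's rule matches 1 - q^(m+k+2) = (1 - q^(m+1)) + q^(m+1) (1 - q^(k+1)). The division-free
form needs no hypothesis on q. -/
theorem gaussBinom_add_mul (q : ℂ) (m k : ℕ) :
    gaussBinom q (m + k) k * (qPoch q q m * qPoch q q k) = qPoch q q (m + k) := by
  induction m generalizing k with
  | zero => simp [gaussBinom_self, qPoch_zero]
  | succ m ihm =>
    induction k with
    | zero => simp [gaussBinom_zero_right, qPoch_zero]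
    | succ k ihk =>
      have h1 := ihm (k + 1)
      have e : m + 1 + k = m + (k + 1) := by omega
      rw [e] at ihk
      rw [← add_assoc (m + 1) k 1, e, gaussBinom_succ_succ, qPoch_succ q q (m + (k + 1)),
        show m + (k + 1) - k = m + 1 by omega]
      rw [qPoch_succ q q m, qPoch_succ q q k] at *
      have h2 : gaussBinom q (m + (k + 1)) (k + 1) *
          (qPoch q q m * (1 - q * q ^ m) * (qPoch q q k * (1 - q * q ^ k)))
          = qPoch q q (m + (k + 1)) * (1 - q * q ^ m) := by
        rw [← h1]; ring
      rw [add_mul, h2]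
      have h3 : q ^ (m + 1) * gaussBinom q (m + (k + 1)) k *
          (qPoch q q m * (1 - q * q ^ m) * (qPoch q q k * (1 - q * q ^ k)))
          = q ^ (m + 1) * qPoch q q (m + (k + 1)) * (1 - q * q ^ k) := by
        rw [← ihk]; ring
      rw [h3]
      ring

theorem gaussBinom_eq_div {q : ℂ} (hq : ‖q‖ < 1) (m k : ℕ) :
    gaussBinom q (m + k) k = qPoch q q (m + k) * (qPoch q q m)⁻¹ * (qPoch q q k)⁻¹ := by
  have h1 := qPoch_self_ne_zero hq m
  have h2 := qPoch_self_ne_zero hq k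
  rw [← gaussBinom_add_mul]
  field_simp

theorem sum_gaussBinom_succ_mul (q : ℂ) (M : ℕ) (X : ℕ → ℂ) :
    ∑ i ∈ range (M + 2), gaussBinom q (M + 1) i * X i =
      ∑ i ∈ range (M + 1), gaussBinom q M i * (X i + q ^ (M - i) * X (i + 1)) := by
  rw [sum_range_succ', gaussBinom_zero_right]
  simp_rw [gaussBinom_succ_succ, add_mul, mul_add, sum_add_distrib]
  have h : ∑ i ∈ range (M + 1), gaussBinom q M i * X i =
      ∑ i ∈ range (M + 1), gaussBinom q M (i + 1) * X (i + 1) + X 0 := by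
    rw [sum_range_succ', gaussBinom_zero_right, one_mul, sum_range_succ,
      gaussBinom_eq_zero q (Nat.lt_succ_self M), zero_mul, add_zero]
  rw [h]
  have h' : ∀ i, q ^ (M - i) * gaussBinom q M i * X (i + 1)
      = gaussBinom q M i * (q ^ (M - i) * X (i + 1)) := fun i => by ring
  simp_rw [h']
  ring

/-- By Pascal's rule the sum F_M(a) satisfies F_(M+1)(a) = (1 - a t q^M) F_M(a) - t q^M (1 - a)
F_M(aq). As the claimed value is independent of a, the two coefficients combine to 1 - t q^M; the
induction must therefore leave a free. -/
theorem sum_qVandermonde (q a t : ℂ) (M : ℕ) :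
    ∑ i ∈ range (M + 1), gaussBinom q M i *
      (qPoch a q i * qPoch (a * t * q ^ i) q (M - i) * (-t) ^ i * q ^ i.choose 2) =
      qPoch t q M := by
  induction M generalizing a with
  | zero => simp [gaussBinom_zero_right, qPoch_zero]
  | succ M ih =>
    rw [sum_gaussBinom_succ_mul, qPoch_succ]
    have h : ∀ i ∈ range (M + 1), gaussBinom q M i *
        (qPoch a q i * qPoch (a * t * q ^ i) q (M + 1 - i) * (-t) ^ i * q ^ i.choose 2 +
          q ^ (M - i) * (qPoch a q (i + 1) * qPoch (a * t * q ^ (i + 1)) q (M + 1 - (i + 1)) *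
            (-t) ^ (i + 1) * q ^ (i + 1).choose 2)) =
        (1 - a * t * q ^ M) * (gaussBinom q M i *
          (qPoch a q i * qPoch (a * t * q ^ i) q (M - i) * (-t) ^ i * q ^ i.choose 2)) -
        t * q ^ M * (1 - a) * (gaussBinom q M i *
          (qPoch (a * q) q i * qPoch (a * q * t * q ^ i) q (M - i) * (-t) ^ i *
            q ^ i.choose 2)) := by
      intro i hi
      obtain ⟨m, rfl⟩ := Nat.exists_eq_add_of_le (Nat.lt_succ_iff.1 (mem_range.1 hi))
      rw [show i + m + 1 - i = m + 1 by omega, show i + m + 1 - (i + 1) = m by omega,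
        show i + m - i = m by omega, qPoch_succ, qPoch_succ', Nat.choose_succ_succ' i 1,
        Nat.choose_one_right]
      rw [show a * q * t * q ^ i = a * t * q ^ (i + 1) by ring]
      ring
    rw [sum_congr rfl h, sum_sub_distrib, ← mul_sum, ← mul_sum, ih, ih]
    ring

/-- The `₁φ₁` summation. -/
theorem tsum_one_phi_one {q t : ℂ} (hq : ‖q‖ < 1) (ht : ‖t‖ < 1) (a : ℂ) :
    ∑' i : ℕ, (qPoch q q i)⁻¹ *
      (qPoch a q i * qPochInf (a * t * q ^ i) q * (-t) ^ i * q ^ i.choose 2) = qPochInf t q := by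
  have hlim : ∀ i : ℕ, Filter.Tendsto (fun M => gaussBinom q M i *
      (qPoch a q i * qPoch (a * t * q ^ i) q (M - i) * (-t) ^ i * q ^ i.choose 2)) Filter.atTop
      (nhds ((qPoch q q i)⁻¹ *
        (qPoch a q i * qPochInf (a * t * q ^ i) q * (-t) ^ i * q ^ i.choose 2))) := by
    intro i
    rw [← Filter.tendsto_add_atTop_iff_nat i]
    simp only [Nat.add_sub_cancel]
    refine Filter.Tendsto.mul ?_ (((tendsto_qPoch _ hq).const_mul _).mul_const _ |>.mul_const _)
    simp_rw [gaussBinom_eq_div hq]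
    have h1 := (Filter.tendsto_add_atTop_iff_nat i).2 (tendsto_qPoch q hq)
    have h2 := (tendsto_qPoch q hq).inv₀ (qPochInf_self_ne_zero hq)
    have := (h1.mul h2).mul_const (qPoch q q i)⁻¹
    rwa [mul_inv_cancel₀ (qPochInf_self_ne_zero hq), one_mul] at this
  set C : ℝ := qBound q * qBound q * qBound q *
    (Real.exp (‖a‖ / (1 - ‖q‖)) * Real.exp (‖a‖ / (1 - ‖q‖))) with hC
  have hg : ∀ M i, ‖gaussBinom q M i‖ ≤ qBound q * qBound q * qBound q := by
    intro M i
    have hb := qBound_nonneg q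
    obtain h | h := lt_or_ge M i
    · rw [gaussBinom_eq_zero q h, norm_zero]; positivity
    · obtain ⟨m, rfl⟩ := Nat.exists_eq_add_of_le' h
      rw [gaussBinom_eq_div hq, norm_mul, norm_mul]
      gcongr
      · exact norm_qPoch_le hq hq.le _
      · exact norm_inv_qPoch_self_le hq _
      · exact norm_inv_qPoch_self_le hq _
  have hbound : ∀ M i, ‖gaussBinom q M i *
      (qPoch a q i * qPoch (a * t * q ^ i) q (M - i) * (-t) ^ i * q ^ i.choose 2)‖ ≤
      C * ‖t‖ ^ i := by
    intro M i
    have hb := qBound_nonneg q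
    have hq' : 0 < 1 - ‖q‖ := sub_pos.2 hq
    have h1 : ‖qPoch (a * t * q ^ i) q (M - i)‖ ≤ Real.exp (‖a‖ / (1 - ‖q‖)) := by
      refine (norm_qPoch_le_exp _ hq _).trans (Real.exp_le_exp.2 ?_)
      gcongr
      rw [mul_assoc, norm_mul]
      exact mul_le_of_le_one_right (norm_nonneg _) (norm_mul_pow_le_one hq ht.le i)
    have h2 : ‖q ^ i.choose 2‖ ≤ 1 := by
      rw [norm_pow]; exact pow_le_one₀ (norm_nonneg _) hq.le
    calc _ = ‖gaussBinom q M i‖ * (‖qPoch a q i‖ * ‖qPoch (a * t * q ^ i) q (M - i)‖ *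
          ‖t‖ ^ i * ‖q ^ i.choose 2‖) := by simp only [norm_mul, norm_pow, norm_neg]
      _ ≤ qBound q * qBound q * qBound q * (Real.exp (‖a‖ / (1 - ‖q‖)) *
          Real.exp (‖a‖ / (1 - ‖q‖)) * ‖t‖ ^ i * 1) := by
        gcongr
        · exact hg M i
        · exact norm_qPoch_le_exp a hq i
      _ = C * ‖t‖ ^ i := by rw [hC]; ring
  -- Tannery's theorem: the bound C |t|^i does not depend on M.
  have hlim2 := tendsto_tsum_of_dominated_convergence
    ((summable_geometric_of_lt_one (norm_nonneg t) ht).mul_left C) hlim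
    (Filter.Eventually.of_forall hbound)
  refine tendsto_nhds_unique hlim2 ((tendsto_qPoch t hq).congr fun M => ?_)
  rw [← sum_qVandermonde q a t M]
  refine (tsum_eq_sum fun i hi => ?_).symm
  rw [gaussBinom_eq_zero q (by simpa using hi), zero_mul]

theorem qPochInf_zero_left {q : ℂ} : qPochInf 0 q = 1 := by simp [qPochInf]

/-- Euler's expansion of `(t; q)_∞`. -/
theorem tsum_euler {q t : ℂ} (hq : ‖q‖ < 1) (ht : ‖t‖ < 1) :
    ∑' i : ℕ, (qPoch q q i)⁻¹ * ((-t) ^ i * q ^ i.choose 2) = qPochInf t q := by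
  rw [← tsum_one_phi_one hq ht 0]
  simp [qPoch_zero_left, qPochInf_zero_left]

/-! ### Andrews' Bailey pair -/

/-- The factor of `A_n(q, q, x)` that is given by a sum, defined by its recurrence. -/
noncomputable def andrewsE (q x : ℂ) : ℕ → ℂ
  | 0 => 1
  | n + 1 => (x - q ^ (n + 1)) * andrewsE q x n +
      (1 + q ^ (n + 1)) / q ^ ((n + 1) ^ 2) * qPoch x q (n + 1)

theorem andrewsE_eq (q x : ℂ) (n : ℕ) :
    andrewsE q x n = ∏ i ∈ Ioc 0 n, (x - q ^ i) +
      ∑ j ∈ Icc 1 n, (1 + q ^ j) / q ^ (j ^ 2) * qPoch x q j * ∏ i ∈ Ioc j n, (x - q ^ i) := by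
  induction n with
  | zero => simp [andrewsE]
  | succ n ih =>
    have h : ∀ j ∈ Icc 1 n, (1 + q ^ j) / q ^ (j ^ 2) * qPoch x q j *
        ∏ i ∈ Ioc j (n + 1), (x - q ^ i) = (x - q ^ (n + 1)) * ((1 + q ^ j) / q ^ (j ^ 2) *
          qPoch x q j * ∏ i ∈ Ioc j n, (x - q ^ i)) := by
      intro j hj
      rw [prod_Ioc_succ_top (mem_Icc.1 hj).2]
      ring
    rw [andrewsE, ih, sum_Icc_succ_top (by omega), sum_congr rfl h, ← mul_sum,
      prod_Ioc_succ_top (Nat.zero_le n), Ioc_self, prod_empty]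
    ring

/-- For a = 1 the coefficient (q)_(j-1) (1 - q^(2j)) / (q)_j collapses to 1 + q^j. -/
theorem andrewsA_one_eq {q : ℂ} (hq : ‖q‖ < 1) (x : ℂ) (n : ℕ) :
    andrewsA 1 q x n = (-1) ^ n * (1 - q ^ (2 * n + 1)) * q ^ (n * (n + 1) / 2 + n ^ 2) /
      ((1 - q) * qPoch (x * q) q n) * andrewsE q x n := by
  rw [andrewsA, andrewsE_eq, pentagonal_eq]
  simp only [one_mul, one_pow, mul_one]
  congr 2
  refine sum_congr rfl fun j hj => ?_
  obtain ⟨j, rfl⟩ := Nat.exists_eq_add_of_le' (mem_Icc.1 hj).1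
  congr 1
  have h1 := qPoch_self_ne_zero hq j
  have h2 := one_sub_pow_ne_zero hq (Nat.succ_ne_zero j)
  rw [Nat.add_sub_cancel, qPoch_succ q q j, ← pow_succ', pow_mul']
  field_simp
  ring

/-- The recurrence of `andrewsE`, normalised by (xq)_n. The inhomogeneous term loses its product
because (x)_(n+1) = (1 - x) (xq)_n, so the telescoping below only meets rational functions of powers
of q. -/
theorem andrewsE_div_succ {q x : ℂ} (hq : ‖q‖ < 1) (hx : ‖x‖ ≤ 1) (n : ℕ) :
    (x - q ^ (n + 1)) * (andrewsE q x n / qPoch (x * q) q n) =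
      (1 - x * q ^ (n + 1)) * (andrewsE q x (n + 1) / qPoch (x * q) q (n + 1)) -
        (1 + q ^ (n + 1)) / q ^ ((n + 1) ^ 2) * (1 - x) := by
  have h1 := qPoch_mul_ne_zero hq hx n
  have h2 := one_sub_mul_pow_ne_zero hq hx (Nat.succ_ne_zero n)
  have h3 : qPoch x q (n + 1) = (1 - x) * qPoch (x * q) q n := qPoch_succ' x q n
  rw [andrewsE, h3, qPoch_succ (x * q), mul_assoc x q, ← pow_succ']
  generalize (1 + q ^ (n + 1)) / q ^ ((n + 1) ^ 2) = c
  field_simp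
  ring

/-- Creative telescoping for the Bailey sum. In the weight, 1 - x q^N multiplies the N-th sum, while
(1 - q^(N-j)) (1 - q^(N+j+1)) lowers both factorials and so produces the sum for N - 1. The closed
form for partial sums is what induction on J needs; its factor 1 - q^(N-J) vanishes at J = N. -/
theorem sum_andrewsE_telescope {q x : ℂ} (hq0 : q ≠ 0) (hq : ‖q‖ < 1) (hx : ‖x‖ ≤ 1)
    {N J : ℕ} (hN : N ≠ 0) (hJ : J ≤ N) :
    ∑ j ∈ range (J + 1), (-1) ^ j * (1 - q ^ (2 * j + 1)) * q ^ (j * (j + 1) / 2 + j ^ 2) *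
        (andrewsE q x j / qPoch (x * q) q j) / (qPoch q q (N - j) * qPoch q q (N + j + 1)) *
        ((1 - x * q ^ N) - (1 - q ^ (N - j)) * (1 - q ^ (N + j + 1))) =
      q ^ N * (1 - q ^ (N - J)) / (qPoch q q (N - J) * qPoch q q (N + J)) *
        ((-1) ^ J * q ^ (J * (J + 1) / 2) * (q ^ (J ^ 2 + 2 * J + 1) / (1 - q ^ (N + J + 1)) *
          ((x - q ^ (J + 1)) * (andrewsE q x J / qPoch (x * q) q J)) + (1 - x) / (1 - q ^ N))) := by
  have hN1 := one_sub_pow_ne_zero hq hN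
  induction J with
  | zero =>
    have h1 := qPoch_self_ne_zero hq N
    have h2 := one_sub_pow_ne_zero hq (Nat.succ_ne_zero N)
    simp only [zero_add, range_one, sum_singleton, pow_zero, mul_zero, Nat.sub_zero, add_zero,
      qPoch_zero, andrewsE, pow_one, ne_eq, OfNat.ofNat_ne_zero, not_false_eq_true,
      zero_pow]
    rw [qPoch_succ q q N, ← pow_succ']
    field_simp
    ring
  | succ J ih =>
    obtain ⟨m, rfl⟩ := Nat.exists_eq_add_of_le hJ
    rw [sum_range_succ, ih (by omega), andrewsE_div_succ hq hx]
    generalize (andrewsE q x (J + 1) / qPoch (x * q) q (J + 1)) = e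
    rw [show J + 1 + m - J = m + 1 by omega, show J + 1 + m - (J + 1) = m by omega,
      show J + 1 + m + (J + 1) = J + 1 + m + J + 1 by omega,
      qPoch_succ q q (J + 1 + m + J + 1), qPoch_succ q q (J + 1 + m + J), qPoch_succ q q m,
      triangle_succ]
    have h1 := qPoch_self_ne_zero hq (J + 1 + m + J)
    have h2 := qPoch_self_ne_zero hq m
    have h3 := one_sub_pow_ne_zero hq (Nat.succ_ne_zero m)
    have h4 := one_sub_pow_ne_zero hq (Nat.succ_ne_zero (J + 1 + m + J))
    have h5 := one_sub_pow_ne_zero hq (Nat.succ_ne_zero (J + 1 + m + J + 1))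
    simp only [Nat.succ_eq_add_one] at h3 h4 h5
    rw [← pow_succ', ← pow_succ', ← pow_succ']
    generalize qPoch q q (J + 1 + m + J) = A at *
    generalize qPoch q q m = B at *
    rw [show q ^ (J + 1 + m + J + 1 + 1) = q ^ J * q ^ J * q ^ m * q ^ 3 by ring] at *
    rw [show q ^ (J + 1 + m + J + 1) = q ^ J * q ^ J * q ^ m * q ^ 2 by ring] at *
    rw [show q ^ (J + 1 + m) = q ^ J * q ^ m * q by ring] at *
    rw [show q ^ (m + 1) = q ^ m * q by ring] at *
    rw [show q ^ (2 * (J + 1) + 1) = q ^ J * q ^ J * q ^ 3 by ring,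
      show q ^ (J * (J + 1) / 2 + (J + 1) + (J + 1) ^ 2) =
        q ^ (J * (J + 1) / 2) * q ^ (J ^ 2) * q ^ J * q ^ J * q ^ J * q ^ 2 by ring,
      show q ^ (J * (J + 1) / 2 + (J + 1)) = q ^ (J * (J + 1) / 2) * q ^ J * q by ring,
      show q ^ (J ^ 2 + 2 * J + 1) = q ^ (J ^ 2) * q ^ J * q ^ J * q by ring,
      show q ^ ((J + 1) ^ 2) = q ^ (J ^ 2) * q ^ J * q ^ J * q by ring,
      show q ^ ((J + 1) ^ 2 + 2 * (J + 1) + 1) = q ^ (J ^ 2) * q ^ J * q ^ J * q ^ J * q ^ J * q ^ 4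
        by ring,
      show q ^ (J + 1 + 1) = q ^ J * q ^ 2 by ring,
      show q ^ (J + 1) = q ^ J * q by ring, show (-1 : ℂ) ^ (J + 1) = - (-1) ^ J by ring]
    have hu : q ^ J ≠ 0 := pow_ne_zero _ hq0
    have hS : q ^ (J ^ 2) ≠ 0 := pow_ne_zero _ hq0
    generalize q ^ (J ^ 2) = S at *
    generalize q ^ (J * (J + 1) / 2) = T at *
    generalize q ^ J = u at *
    generalize q ^ m = v at *
    generalize (-1 : ℂ) ^ J = s at *
    clear ih
    -- The denominators are kept as atoms while they are cleared, and expanded only for the final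
    -- polynomial identity.
    obtain ⟨d1, e1⟩ : ∃ d, d = 1 - u * v * q := ⟨_, rfl⟩
    obtain ⟨d3, e3⟩ : ∃ d, d = 1 - v * q := ⟨_, rfl⟩
    obtain ⟨d4, e4⟩ : ∃ d, d = 1 - u * u * v * q ^ 2 := ⟨_, rfl⟩
    obtain ⟨d5, e5⟩ : ∃ d, d = 1 - u * u * v * q ^ 3 := ⟨_, rfl⟩
    rw [← e1] at hN1 ⊢
    rw [← e3] at h3 ⊢
    rw [← e4] at h4 ⊢
    rw [← e5] at h5 ⊢
    field_simp
    subst e1 e3 e4 e5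
    ring

/-- `A_n(q, q, x)` and `1 / (x q; q)_n` form a Bailey pair relative to `(q, q)`. -/
theorem sum_andrewsA_eq {q x : ℂ} (hq0 : q ≠ 0) (hq : ‖q‖ < 1) (hx : ‖x‖ ≤ 1) (n : ℕ) :
    ∑ j ∈ range (n + 1), (1 - q) * andrewsA 1 q x j *
        ((qPoch q q (n - j))⁻¹ * (qPoch q q (n + j + 1))⁻¹) = (qPoch (x * q) q n)⁻¹ := by
  have hq' : 1 - q ≠ 0 := by simpa using one_sub_pow_ne_zero hq one_ne_zero
  have hA : ∀ j, (1 - q) * andrewsA 1 q x j = (-1) ^ j * (1 - q ^ (2 * j + 1)) *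
      q ^ (j * (j + 1) / 2 + j ^ 2) * (andrewsE q x j / qPoch (x * q) q j) := by
    intro j
    have := qPoch_mul_ne_zero hq hx j
    rw [andrewsA_one_eq hq]
    field_simp
  simp_rw [hA]
  induction n with
  | zero => simp [qPoch_zero, andrewsE, qPoch_one, hq']
  | succ n ih =>
    have h1 := qPoch_mul_ne_zero hq hx n
    have h2 := one_sub_mul_pow_ne_zero hq hx (Nat.succ_ne_zero n)
    -- At J = N = n + 1 the closed form is zero, so (1 - x q^N) times the N-th Bailey sum equals the
    -- previous one; 1/(xq)_n obeys the same recurrence.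
    have key := sum_andrewsE_telescope hq0 hq hx (Nat.succ_ne_zero n) le_rfl
    rw [Nat.sub_self, pow_zero, sub_self, mul_zero, zero_div, zero_mul] at key
    simp_rw [mul_sub _ (1 - x * q ^ n.succ)] at key
    rw [sum_sub_distrib, sub_eq_zero, ← sum_mul] at key
    conv_rhs at key => rw [sum_range_succ, Nat.sub_self, pow_zero, sub_self, zero_mul, mul_zero,
      add_zero]
    have e : ∀ j ∈ range n.succ, (-1) ^ j * (1 - q ^ (2 * j + 1)) *
        q ^ (j * (j + 1) / 2 + j ^ 2) * (andrewsE q x j / qPoch (x * q) q j) /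
          (qPoch q q (n.succ - j) * qPoch q q (n.succ + j + 1)) *
          ((1 - q ^ (n.succ - j)) * (1 - q ^ (n.succ + j + 1))) =
        (-1) ^ j * (1 - q ^ (2 * j + 1)) *
          q ^ (j * (j + 1) / 2 + j ^ 2) * (andrewsE q x j / qPoch (x * q) q j) *
          ((qPoch q q (n - j))⁻¹ * (qPoch q q (n + j + 1))⁻¹) := by
      intro j hj
      have hj' : j ≤ n := Nat.lt_succ_iff.1 (mem_range.1 hj)
      have h3 := one_sub_pow_ne_zero hq (Nat.succ_ne_zero (n - j))
      have h4 := one_sub_pow_ne_zero hq (Nat.succ_ne_zero (n + j + 1))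
      have h5 := qPoch_self_ne_zero hq (n - j)
      have h6 := qPoch_self_ne_zero hq (n + j + 1)
      rw [show n.succ - j = (n - j) + 1 by omega, show n.succ + j + 1 = n + j + 1 + 1 by omega,
        qPoch_succ q q (n - j), qPoch_succ q q (n + j + 1), ← pow_succ', ← pow_succ']
      simp only [Nat.succ_eq_add_one] at h3 h4
      generalize (-1) ^ j * (1 - q ^ (2 * j + 1)) *
        q ^ (j * (j + 1) / 2 + j ^ 2) * (andrewsE q x j / qPoch (x * q) q j) = c
      field_simp
    rw [sum_congr rfl e, ih] at key
    rw [qPoch_succ (x * q), mul_assoc x q, ← pow_succ', mul_inv, ← key, mul_assoc,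
      mul_inv_cancel₀ h2, mul_one]
    exact sum_congr rfl fun j _ => by simp only [div_eq_mul_inv, mul_inv]

/-! ### A finite expansion of `∏ (y + q ^ i) / (x q; q)_n` -/

/-- The partial sums of `∑ (x; q)_i / (q; q)_i (-z) ^ i`. -/
noncomputable def qBinomPartial (q x z : ℂ) (j : ℕ) : ℂ :=
  ∑ i ∈ range (j + 1), qPoch x q i / qPoch q q i * (-z) ^ i

theorem qBinomPartial_zero (q x z : ℂ) : qBinomPartial q x z 0 = 1 := by
  simp [qBinomPartial, qPoch_zero]

theorem qBinomPartial_succ (q x z : ℂ) (j : ℕ) : qBinomPartial q x z (j + 1) =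
    qBinomPartial q x z j + qPoch x q (j + 1) / qPoch q q (j + 1) * (-z) ^ (j + 1) := by
  rw [qBinomPartial, sum_range_succ]; rfl

/-- A truncated form of the equation behind the q-binomial theorem: all coefficients cancel except
the one of z^(j+1). -/
theorem qBinomPartial_functional {q : ℂ} (hq : ‖q‖ < 1) (x z : ℂ) (j : ℕ) :
    (1 + z) * qBinomPartial q x z j - (1 + x * z) * qBinomPartial q x (z * q) j =
      z * (-z) ^ j * qPoch x q (j + 1) / qPoch q q j := by
  induction j with
  | zero => simp [qBinomPartial_zero, qPoch_zero, qPoch_one]; ring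
  | succ j ih =>
    have h1 := qPoch_self_ne_zero hq j
    have h2 := one_sub_pow_ne_zero hq (Nat.succ_ne_zero j)
    rw [qBinomPartial_succ, qBinomPartial_succ, mul_add, mul_add, add_sub_add_comm, ih,
      qPoch_succ x q (j + 1), qPoch_succ q q j, ← pow_succ', ← neg_mul, mul_pow]
    simp only [Nat.succ_eq_add_one] at h2
    field_simp
    ring

/-- The same device as `sum_andrewsE_telescope`: the weight compares the sum for N with y + q^N
times the sum for N - 1, and the right side vanishes at J = N. -/
theorem sum_qBinomPartial_telescope {q x y : ℂ} (hq : ‖q‖ < 1) (hx : ‖x‖ ≤ 1)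
    {N J : ℕ} (hN : N ≠ 0) (hJ : J ≤ N) :
    ∑ j ∈ range (J + 1), y ^ (N - j) * q ^ (j * (j + 1) / 2) * qBinomPartial q x y j /
        (qPoch (x * q) q j * qPoch q q (N - j)) *
        (y * (1 - x * q ^ N) - (y + q ^ N) * (1 - q ^ (N - j))) =
      (1 - q ^ (N - J)) * q ^ N * y ^ (N - J) / qPoch q q (N - J) *
        ((1 - x) * y ^ (J + 1) * (-1) ^ J * q ^ (J * (J + 1) / 2) / (qPoch q q J * (1 - q ^ N)) -
          q ^ (J * (J + 1) / 2) * qBinomPartial q x y J / qPoch (x * q) q J) := by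
  have hN1 := one_sub_pow_ne_zero hq hN
  induction J with
  | zero =>
    have h1 := qPoch_self_ne_zero hq N
    simp only [zero_add, range_one, sum_singleton, pow_zero, Nat.sub_zero, mul_one,
      qPoch_zero, pow_one, Nat.zero_div, qBinomPartial_zero]
    field_simp
    ring
  | succ J ih =>
    obtain ⟨m, rfl⟩ := Nat.exists_eq_add_of_le hJ
    have h0 := qPoch_mul_ne_zero hq hx J
    have h0' := one_sub_mul_pow_ne_zero hq hx (Nat.succ_ne_zero J)
    have h1 := qPoch_self_ne_zero hq J
    have h2 := qPoch_self_ne_zero hq m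
    have h3 := one_sub_pow_ne_zero hq (Nat.succ_ne_zero m)
    have h4 := one_sub_pow_ne_zero hq (Nat.succ_ne_zero J)
    simp only [Nat.succ_eq_add_one] at h3 h4 h0'
    have hx' : qPoch x q (J + 1) = (1 - x) * qPoch (x * q) q J := qPoch_succ' x q J
    rw [sum_range_succ, ih (by omega), qBinomPartial_succ, hx']
    rw [show J + 1 + m - J = m + 1 by omega, show J + 1 + m - (J + 1) = m by omega,
      qPoch_succ q q J, qPoch_succ q q m, triangle_succ, qPoch_succ (x * q), mul_assoc x q,
      ← pow_succ', ← pow_succ', neg_pow y]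
    generalize qBinomPartial q x y J = b at *
    generalize qPoch (x * q) q J = D at *
    generalize qPoch q q J = A at *
    generalize qPoch q q m = B at *
    rw [show q ^ (J + 1 + m) = q ^ J * q ^ m * q by ring] at *
    rw [show q ^ (m + 1) = q ^ m * q by ring] at *
    rw [show q ^ (J + 1) = q ^ J * q by ring] at *
    rw [show q ^ (J * (J + 1) / 2 + (J + 1)) = q ^ (J * (J + 1) / 2) * q ^ J * q by ring,
      show (-1 : ℂ) ^ (J + 1) = - (-1) ^ J by ring]
    generalize q ^ (J * (J + 1) / 2) = T at *
    generalize q ^ J = u at *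
    generalize q ^ m = v at *
    generalize (-1 : ℂ) ^ J = s at *
    clear ih
    obtain ⟨d0, e0⟩ : ∃ d, d = 1 - x * (u * q) := ⟨_, rfl⟩
    obtain ⟨d1, e1⟩ : ∃ d, d = 1 - u * v * q := ⟨_, rfl⟩
    obtain ⟨d3, e3⟩ : ∃ d, d = 1 - v * q := ⟨_, rfl⟩
    obtain ⟨d4, e4⟩ : ∃ d, d = 1 - u * q := ⟨_, rfl⟩
    rw [← e0] at h0' ⊢
    rw [← e1] at hN1 ⊢
    rw [← e3] at h3 ⊢
    rw [← e4] at h4 ⊢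
    field_simp
    subst e0 e1 e3 e4
    ring

theorem prod_add_pow_div_qPoch {q x y : ℂ} (hq : ‖q‖ < 1) (hx : ‖x‖ ≤ 1) (hy : y ≠ 0) (n : ℕ) :
    (∏ i ∈ range n, (y + q ^ (i + 1))) * (qPoch (x * q) q n)⁻¹ =
      ∑ j ∈ range (n + 1), y ^ (n - j) * q ^ (j * (j + 1) / 2) * qBinomPartial q x y j *
        ((qPoch (x * q) q j)⁻¹ * (qPoch q q (n - j))⁻¹) := by
  induction n with
  | zero => simp [qPoch_zero, qBinomPartial_zero]
  | succ n ih =>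
    have h1 := qPoch_mul_ne_zero hq hx n
    have h2 := one_sub_mul_pow_ne_zero hq hx (Nat.succ_ne_zero n)
    have key := sum_qBinomPartial_telescope (y := y) hq hx (Nat.succ_ne_zero n) le_rfl
    rw [Nat.sub_self, pow_zero, sub_self, zero_mul, zero_mul, zero_div, zero_mul] at key
    simp_rw [mul_sub _ (y * _)] at key
    rw [sum_sub_distrib, sub_eq_zero, ← sum_mul] at key
    conv_rhs at key => rw [sum_range_succ, Nat.sub_self, pow_zero, pow_zero, sub_self, mul_zero,
      mul_zero, add_zero]
    have e : ∀ j ∈ range n.succ, y ^ (n.succ - j) * q ^ (j * (j + 1) / 2) *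
          qBinomPartial q x y j / (qPoch (x * q) q j * qPoch q q (n.succ - j)) *
          ((y + q ^ n.succ) * (1 - q ^ (n.succ - j))) =
        y * (y + q ^ n.succ) * (y ^ (n - j) * q ^ (j * (j + 1) / 2) * qBinomPartial q x y j *
        ((qPoch (x * q) q j)⁻¹ * (qPoch q q (n - j))⁻¹)) := by
      intro j hj
      have hj' : j ≤ n := Nat.lt_succ_iff.1 (mem_range.1 hj)
      have h3 := one_sub_pow_ne_zero hq (Nat.succ_ne_zero (n - j))
      have h5 := qPoch_self_ne_zero hq (n - j)
      have h6 := qPoch_mul_ne_zero hq hx j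
      rw [show n.succ - j = (n - j) + 1 by omega, qPoch_succ q q (n - j), ← pow_succ',
        pow_succ y]
      simp only [Nat.succ_eq_add_one] at h3
      generalize q ^ (j * (j + 1) / 2) * qBinomPartial q x y j = c
      field_simp
    rw [sum_congr rfl e, ← mul_sum, ← ih] at key
    rw [prod_range_succ, qPoch_succ (x * q), mul_assoc x q, ← pow_succ', mul_inv]
    have key2 : (∑ j ∈ range (n + 1 + 1), y ^ (n + 1 - j) * q ^ (j * (j + 1) / 2) *
        qBinomPartial q x y j * ((qPoch (x * q) q j)⁻¹ * (qPoch q q (n + 1 - j))⁻¹)) *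
          (y * (1 - x * q ^ (n + 1))) = y * (y + q ^ n.succ) *
            ((∏ i ∈ range n, (y + q ^ (i + 1))) * (qPoch (x * q) q n)⁻¹) := by
      rw [← key]
      congr 1
      exact sum_congr rfl fun j _ => by simp only [div_eq_mul_inv, mul_inv]
    -- The telescoped recurrence carries a spare factor y, from y^(N-j) = y · y^(N-1-j); cancelling
    -- it uses y ≠ 0.
    refine mul_right_cancel₀ (mul_ne_zero hy h2) (Eq.trans ?_ key2.symm)
    simp only [Nat.succ_eq_add_one] at h2 ⊢
    generalize 1 - x * q ^ (n + 1) = d at *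
    field_simp

/-! ### Bounds for the series -/

theorem norm_pow_le_pow {q : ℂ} (hq : ‖q‖ < 1) {m n : ℕ} (h : m ≤ n) : ‖q ^ n‖ ≤ ‖q‖ ^ m := by
  rw [norm_pow]
  exact pow_le_pow_of_le_one (norm_nonneg q) hq.le h

theorem norm_pow_le_one {q : ℂ} (hq : ‖q‖ ≤ 1) (n : ℕ) : ‖q ^ n‖ ≤ 1 := by
  rw [norm_pow]
  exact pow_le_one₀ (norm_nonneg q) hq

/-- Each of the n + 1 copies of r^n is at most the corresponding term r^i of the geometric series.
This absorbs the linear growth of the partial sums S_j. -/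
theorem succ_mul_pow_le {r : ℝ} (hr0 : 0 ≤ r) (hr1 : r < 1) (n : ℕ) :
    ((n : ℝ) + 1) * r ^ n ≤ (1 - r)⁻¹ := by
  calc ((n : ℝ) + 1) * r ^ n = ∑ i ∈ range (n + 1), r ^ n := by simp
    _ ≤ ∑ i ∈ range (n + 1), r ^ i := sum_le_sum fun i hi =>
        pow_le_pow_of_le_one hr0 hr1.le (Nat.lt_succ_iff.1 (mem_range.1 hi))
    _ ≤ (1 - r)⁻¹ := by
        rw [← tsum_geometric_of_lt_one hr0 hr1]
        exact (summable_geometric_of_lt_one hr0 hr1).sum_le_tsum _ fun i _ => by positivity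

theorem norm_qBinomPartial_le {q x z : ℂ} (hq : ‖q‖ < 1) (hx : ‖x‖ ≤ 1) (hz : ‖z‖ ≤ 1) (j : ℕ) :
    ‖qBinomPartial q x z j‖ ≤ (j + 1) * (qBound q * qBound q) := by
  have hb := qBound_nonneg q
  calc ‖qBinomPartial q x z j‖ ≤ ∑ i ∈ range (j + 1), qBound q * qBound q := by
        refine norm_sum_le_of_le _ fun i _ => ?_
        rw [norm_mul, div_eq_mul_inv, norm_mul, norm_pow, norm_neg]
        refine (mul_le_of_le_one_right (by positivity) (pow_le_one₀ (norm_nonneg z) hz)).trans ?_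
        gcongr
        · exact norm_qPoch_le hq hx i
        · exact norm_inv_qPoch_self_le hq i
    _ = (j + 1) * (qBound q * qBound q) := by simp

theorem norm_pow_mul_qBinomPartial_le {q x z : ℂ} (hq : ‖q‖ < 1) (hx : ‖x‖ ≤ 1) (hz : ‖z‖ ≤ 1)
    {j e : ℕ} (he : j ≤ e) :
    ‖q ^ e * qBinomPartial q x z j‖ ≤ (1 - ‖q‖)⁻¹ * (qBound q * qBound q) := by
  have hb := qBound_nonneg q
  calc ‖q ^ e * qBinomPartial q x z j‖
      ≤ ‖q‖ ^ j * ((j + 1) * (qBound q * qBound q)) := by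
        rw [norm_mul]
        gcongr
        · exact norm_pow_le_pow hq he
        · exact norm_qBinomPartial_le hq hx hz j
    _ = ((j + 1) * ‖q‖ ^ j) * (qBound q * qBound q) := by ring
    _ ≤ _ := by gcongr; exact succ_mul_pow_le (norm_nonneg q) hq j

/-- The finite product `(y + q) (y + q ^ 2) ⋯ (y + q ^ n)`. -/
noncomputable def shiftedProd (y q : ℂ) (n : ℕ) : ℂ := ∏ i ∈ range n, (y + q ^ (i + 1))

theorem norm_shiftedProd_le {y q : ℂ} (hq : ‖q‖ < 1) (hy : ‖y‖ ≤ 1) (n : ℕ) :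
    ‖shiftedProd y q n‖ ≤ qBound q :=
  norm_prod_range_le_qBound hq _ (fun i => (norm_add_le _ _).trans
    (add_le_add hy (norm_pow_le_pow hq (Nat.le_succ i)))) n

/-- Puts the tail of the product in the form (a)_m with a = -q^(j+1)/y, as the ₁φ₁ sum requires. -/
theorem shiftedProd_add (y q : ℂ) (hy : y ≠ 0) (j m : ℕ) :
    shiftedProd y q (j + m) = shiftedProd y q j * (y ^ m * qPoch (-q ^ (j + 1) / y) q m) := by
  rw [shiftedProd, prod_range_add, shiftedProd, qPoch]
  congr 1
  rw [← card_range m, ← prod_const, card_range, ← prod_mul_distrib]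
  refine prod_congr rfl fun i _ => ?_
  field_simp
  ring

/-- `andrewsE` grows like q^(-n^2), but F_n = q^(n^2) E_n satisfies F_(n+1) = (x - q^(n+1)) q^(2n+1)
F_n + (1 + q^(n+1)) (x)_(n+1), whose contraction factor q^(2n+1) and bounded inhomogeneity keep F_n
bounded. -/
theorem norm_one_sub_mul_andrewsA_le {q x : ℂ} (hq0 : q ≠ 0) (hq : ‖q‖ < 1) (hx : ‖x‖ ≤ 1) :
    ∃ K : ℝ, 0 ≤ K ∧ ∀ n, ‖(1 - q) * andrewsA 1 q x n‖ ≤ K := by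
  have hb := qBound_nonneg q
  have hr : 0 < 1 - ‖q‖ := sub_pos.2 hq
  -- Chosen so that |q| M + 2 `qBound q` = M - 1, which closes the induction step, and so that M ≥
  -- 1, which starts it.
  obtain ⟨M, hM⟩ : ∃ M : ℝ, M = (1 + 2 * qBound q) / (1 - ‖q‖) := ⟨_, rfl⟩
  have hM0 : 0 ≤ M := by rw [hM]; positivity
  have hM1 : ‖q‖ * M + 2 * qBound q ≤ M := by
    have : M * (1 - ‖q‖) = 1 + 2 * qBound q := by rw [hM]; field_simp
    linarith
  have hP1 : ∀ n, 1 ≤ ∏ i ∈ range n, (1 + 1 * ‖q‖ ^ i) := fun n => by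
    calc (1 : ℝ) = ∏ i ∈ range n, 1 := by simp
      _ ≤ _ := prod_le_prod (fun _ _ => zero_le_one) fun i _ => by simp
  have hE : ∀ n, ‖q ^ (n ^ 2) * andrewsE q x n‖ ≤ (∏ i ∈ range n, (1 + 1 * ‖q‖ ^ i)) * M := by
    intro n
    induction n with
    | zero =>
      have : 1 ≤ M := by rw [hM, one_le_div hr]; linarith [norm_nonneg q]
      simpa [andrewsE] using this
    | succ n ih =>
      have e : q ^ ((n + 1) ^ 2) * andrewsE q x (n + 1) =
          (x - q ^ (n + 1)) * q ^ (2 * n + 1) * (q ^ (n ^ 2) * andrewsE q x n) +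
            (1 + q ^ (n + 1)) * qPoch x q (n + 1) := by
        have := pow_ne_zero ((n + 1) ^ 2) hq0
        rw [andrewsE, mul_add]
        congr 1
        · ring
        · field_simp
      have h1 : ‖x - q ^ (n + 1)‖ ≤ 1 + 1 * ‖q‖ ^ n := by
        rw [one_mul]
        exact (norm_sub_le _ _).trans (add_le_add hx (norm_pow_le_pow hq (Nat.le_succ n)))
      have h2 : ‖q ^ (2 * n + 1)‖ ≤ ‖q‖ := by
        simpa using norm_pow_le_pow hq (show 1 ≤ 2 * n + 1 by omega)
      have h3 : ‖1 + q ^ (n + 1)‖ ≤ 2 := by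
        refine (norm_add_le _ _).trans ?_
        rw [norm_one]
        linarith [norm_pow_le_one hq.le (n + 1)]
      rw [e]
      calc _ ≤ (1 + 1 * ‖q‖ ^ n) * ‖q‖ * ((∏ i ∈ range n, (1 + 1 * ‖q‖ ^ i)) * M) +
            2 * qBound q := by
            refine (norm_add_le _ _).trans (add_le_add ?_ ?_)
            · rw [norm_mul, norm_mul]; gcongr
            · rw [norm_mul]; gcongr; exact norm_qPoch_le hq hx _
        _ ≤ (1 + 1 * ‖q‖ ^ n) * ‖q‖ * ((∏ i ∈ range n, (1 + 1 * ‖q‖ ^ i)) * M) +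
            (∏ i ∈ range (n + 1), (1 + 1 * ‖q‖ ^ i)) * (2 * qBound q) := by
            exact add_le_add le_rfl
              (le_mul_of_one_le_left (mul_nonneg zero_le_two hb) (hP1 (n + 1)))
        _ = (∏ i ∈ range (n + 1), (1 + 1 * ‖q‖ ^ i)) * (‖q‖ * M + 2 * qBound q) := by
            rw [prod_range_succ]; ring
        _ ≤ _ := by gcongr
  refine ⟨2 * qBound q * (Real.exp (1 / (1 - ‖q‖)) * M), by positivity, fun n => ?_⟩
  have hq' : 1 - q ≠ 0 := by simpa using one_sub_pow_ne_zero hq one_ne_zero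
  have e : (1 - q) * andrewsA 1 q x n = (-1) ^ n * (1 - q ^ (2 * n + 1)) *
      q ^ (n * (n + 1) / 2) * (qPoch (x * q) q n)⁻¹ * (q ^ (n ^ 2) * andrewsE q x n) := by
    have := qPoch_mul_ne_zero hq hx n
    rw [andrewsA_one_eq hq]
    field_simp
    ring
  have h3 : ‖1 - q ^ (2 * n + 1)‖ ≤ 2 := by
    refine (norm_sub_le _ _).trans ?_
    rw [norm_one]
    linarith [norm_pow_le_one hq.le (2 * n + 1)]
  rw [e]
  calc _ = ‖1 - q ^ (2 * n + 1)‖ * ‖q ^ (n * (n + 1) / 2)‖ * ‖(qPoch (x * q) q n)⁻¹‖ *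
        ‖q ^ (n ^ 2) * andrewsE q x n‖ := by simp
    _ ≤ 2 * 1 * qBound q * (Real.exp (1 / (1 - ‖q‖)) * M) := by
        gcongr
        · exact norm_pow_le_one hq.le _
        · exact norm_inv_qPoch_mul_le hq hx n
        · refine (hE n).trans ?_
          gcongr
          exact prod_one_add_le_exp (norm_nonneg q) hq zero_le_one n
    _ = _ := by ring

/-! ### Summability -/

theorem tsum_tsum_mul_comm {b : ℕ → ℂ} {w : ℕ → ℕ → ℂ}
    (h : Summable fun p : ℕ × ℕ => b p.1 * w p.1 p.2) :
    ∑' k, ∑' j, b j * w j k = ∑' j, b j * ∑' k, w j k := by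
  simp_rw [← tsum_mul_left]
  exact h.tsum_comm

section Main

variable {q x y : ℂ}

theorem summable_shiftedProd (hq : ‖q‖ < 1) (hx : ‖x‖ ≤ 1) (hy : ‖y‖ ≤ 1) :
    Summable fun n : ℕ =>
      shiftedProd y q n * q ^ (n * (n + 1) / 2) * (qPoch (x * q) q n)⁻¹ := by
  have hb := qBound_nonneg q
  refine summable_of_norm_le_geometric (C := qBound q * qBound q) (norm_nonneg q) hq fun n => ?_
  rw [norm_mul, norm_mul]
  calc _ ≤ qBound q * ‖q‖ ^ n * qBound q := by
        gcongr
        · exact norm_shiftedProd_le hq hy n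
        · exact norm_pow_le_pow hq (le_triangle n)
        · exact norm_inv_qPoch_mul_le hq hx n
    _ = _ := by ring

theorem summable_pow_div_qPoch_mul (hq : ‖q‖ < 1) (hx : ‖x‖ ≤ 1) (hy : ‖y‖ ≤ 1) :
    Summable fun n : ℕ => q ^ (n * (n + 1)) / (qPoch (-y) q (n + 1) * qPoch (x * q) q n) := by
  have hb := qBound_nonneg q
  refine summable_of_norm_le_geometric (C := ‖(1 + y)⁻¹‖ * qBound q * qBound q)
    (norm_nonneg q) hq fun n => ?_
  rw [div_eq_mul_inv, mul_inv, norm_mul, norm_mul]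
  calc _ ≤ ‖q‖ ^ n * (‖(1 + y)⁻¹‖ * qBound q * qBound q) := by
        gcongr
        · exact norm_pow_le_pow hq (Nat.le_mul_of_pos_right n n.succ_pos)
        · exact norm_inv_qPoch_neg_succ_le hq hy n
        · exact norm_inv_qPoch_mul_le hq hx n
    _ = _ := by ring

theorem norm_qPoch_div_qPoch_succ_le (hq : ‖q‖ < 1) (hx : ‖x‖ ≤ 1) (hy : ‖y‖ ≤ 1) (k : ℕ) :
    ‖qPoch (-(x * y)) q k / qPoch (-y) q (k + 1)‖ ≤ qBound q * (‖(1 + y)⁻¹‖ * qBound q) := by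
  have hb := qBound_nonneg q
  rw [div_eq_mul_inv, norm_mul]
  gcongr
  · refine norm_qPoch_le hq ?_ k
    rw [norm_neg, norm_mul]
    exact mul_le_one₀ hx (norm_nonneg y) hy
  · exact norm_inv_qPoch_neg_succ_le hq hy k

theorem summable_qPoch_div_mul_pow (hq : ‖q‖ < 1) (hx : ‖x‖ ≤ 1) (hy : ‖y‖ ≤ 1) (n : ℕ) :
    Summable fun k : ℕ =>
      qPoch (-(x * y)) q k / qPoch (-y) q (k + 1) * q ^ ((n + 1) * k) := by
  have hb := qBound_nonneg q
  refine summable_of_norm_le_geometric (C := qBound q * (‖(1 + y)⁻¹‖ * qBound q))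
    (norm_nonneg q) hq fun k => ?_
  rw [norm_mul]
  gcongr
  · exact norm_qPoch_div_qPoch_succ_le hq hx hy k
  · exact norm_pow_le_pow hq (Nat.le_mul_of_pos_left k n.succ_pos)

theorem summable_double (hq : ‖q‖ < 1) (hx : ‖x‖ ≤ 1) (hy : ‖y‖ ≤ 1) {b : ℕ → ℂ} {K : ℝ}
    (hK : 0 ≤ K) (hb : ∀ n, ‖b n‖ ≤ K * ‖q‖ ^ n) :
    Summable fun p : ℕ × ℕ => b p.1 *
      (qPoch (-(x * y)) q p.2 / qPoch (-y) q (p.2 + 1) * q ^ ((p.1 + 1) * p.2)) := by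
  have hb' := qBound_nonneg q
  refine summable_prod_of_norm_le_geometric (C := K * (qBound q * (‖(1 + y)⁻¹‖ * qBound q)))
    (norm_nonneg q) hq fun n k => ?_
  rw [norm_mul, norm_mul]
  calc _ ≤ K * ‖q‖ ^ n * ((qBound q * (‖(1 + y)⁻¹‖ * qBound q)) * ‖q‖ ^ k) := by
        gcongr
        · exact hb n
        · exact norm_qPoch_div_qPoch_succ_le hq hx hy k
        · exact norm_pow_le_pow hq (Nat.le_mul_of_pos_left k n.succ_pos)
    _ = _ := by ring

theorem norm_double_coeff_le (hq : ‖q‖ < 1) (hy : ‖y‖ ≤ 1) (n : ℕ) :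
    ‖(-1) ^ n * y ^ n * q ^ (n * (n + 1)) / (qPoch q q n * qPoch (-y) q (n + 1))‖ ≤
      (qBound q * (‖(1 + y)⁻¹‖ * qBound q)) * ‖q‖ ^ n := by
  have hb := qBound_nonneg q
  rw [div_eq_mul_inv, mul_inv, norm_mul, norm_mul, norm_mul, norm_mul]
  calc _ ≤ 1 * 1 * ‖q‖ ^ n * (qBound q * (‖(1 + y)⁻¹‖ * qBound q)) := by
        gcongr
        · simp
        · exact norm_pow_le_one hy n
        · exact norm_pow_le_pow hq (Nat.le_mul_of_pos_right n n.succ_pos)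
        · exact norm_inv_qPoch_self_le hq n
        · exact norm_inv_qPoch_neg_succ_le hq hy n
    _ = _ := by ring

theorem summable_double_outer (hq : ‖q‖ < 1) (hx : ‖x‖ ≤ 1) (hy : ‖y‖ ≤ 1) :
    Summable fun n : ℕ =>
      (-1) ^ n * y ^ n * q ^ (n * (n + 1)) / (qPoch q q n * qPoch (-y) q (n + 1)) *
        ∑' k : ℕ, qPoch (-(x * y)) q k / qPoch (-y) q (k + 1) * q ^ ((n + 1) * k) := by
  have hb := qBound_nonneg q
  refine (summable_double hq hx hy (by positivity) (norm_double_coeff_le hq hy)).prod.congr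
    fun n => ?_
  dsimp only
  rw [tsum_mul_left]

theorem summable_andrewsA (hq0 : q ≠ 0) (hq : ‖q‖ < 1) (hx : ‖x‖ ≤ 1) (hy : ‖y‖ ≤ 1) :
    Summable fun n : ℕ => shiftedProd y q n * q ^ (n * (n + 1) / 2) * andrewsA 1 q x n /
      qPoch (-y) q (n + 1) := by
  have hb := qBound_nonneg q
  have hq' : 1 - q ≠ 0 := by simpa using one_sub_pow_ne_zero hq one_ne_zero
  obtain ⟨K, hK0, hK⟩ := norm_one_sub_mul_andrewsA_le hq0 hq hx
  refine summable_of_norm_le_geometric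
    (C := ‖(1 - q)⁻¹‖ * qBound q * K * (‖(1 + y)⁻¹‖ * qBound q)) (norm_nonneg q) hq fun n => ?_
  have e : shiftedProd y q n * q ^ (n * (n + 1) / 2) * andrewsA 1 q x n / qPoch (-y) q (n + 1) =
      (1 - q)⁻¹ * shiftedProd y q n * q ^ (n * (n + 1) / 2) * ((1 - q) * andrewsA 1 q x n) *
        (qPoch (-y) q (n + 1))⁻¹ := by
    field_simp
  rw [e, norm_mul, norm_mul, norm_mul, norm_mul]
  calc _ ≤ ‖(1 - q)⁻¹‖ * qBound q * ‖q‖ ^ n * K * (‖(1 + y)⁻¹‖ * qBound q) := by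
        gcongr
        · exact norm_shiftedProd_le hq hy n
        · exact norm_pow_le_pow hq (le_triangle n)
        · exact hK n
        · exact norm_inv_qPoch_neg_succ_le hq hy n
    _ = _ := by ring

/-! ### The two evaluations -/

theorem tsum_shiftedProd_eq_tsum_qBinomPartial (hq : ‖q‖ < 1) (hx : ‖x‖ ≤ 1) (hy : ‖y‖ ≤ 1)
    (hy0 : y ≠ 0) :
    ∑' n : ℕ, shiftedProd y q n * q ^ (n * (n + 1) / 2) * (qPoch (x * q) q n)⁻¹ =
      ∑' j : ℕ, q ^ (j * (j + 1)) * qPochInf (-y * q ^ (j + 1)) q * (qPoch (x * q) q j)⁻¹ *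
        qBinomPartial q x y j := by
  have hb := qBound_nonneg q
  have hr : 0 < 1 - ‖q‖ := sub_pos.2 hq
  let f : ℕ × ℕ → ℂ := fun p => q ^ ((p.1 + p.2) * (p.1 + p.2 + 1) / 2) *
    (y ^ p.2 * (q ^ (p.1 * (p.1 + 1) / 2) * qBinomPartial q x y p.1) *
      ((qPoch (x * q) q p.1)⁻¹ * (qPoch q q p.2)⁻¹))
  have hf : Summable f := by
    -- The exponent of the original series gives the decay |q|^(j+m); the one from the finite
    -- expansion pays for the growth of S_j.
    refine summable_prod_of_norm_le_geometric
      (C := (1 - ‖q‖)⁻¹ * (qBound q * qBound q) * (qBound q * qBound q))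
      (norm_nonneg q) hq fun j m => ?_
    simp only [f]
    rw [norm_mul, norm_mul, norm_mul, norm_mul _⁻¹]
    calc _ ≤ ‖q‖ ^ (j + m) * (1 * ((1 - ‖q‖)⁻¹ * (qBound q * qBound q)) *
          (qBound q * qBound q)) := by
          gcongr
          · exact norm_pow_le_pow hq (le_triangle _)
          · exact norm_pow_le_one hy m
          · exact norm_pow_mul_qBinomPartial_le hq hx hy (le_triangle j)
          · exact norm_inv_qPoch_mul_le hq hx j
          · exact norm_inv_qPoch_self_le hq m
      _ = _ := by rw [pow_add]; ring
  have h1 : ∀ n : ℕ, shiftedProd y q n * q ^ (n * (n + 1) / 2) * (qPoch (x * q) q n)⁻¹ =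
      ∑ j ∈ range (n + 1), f (j, n - j) := by
    intro n
    rw [shiftedProd, mul_right_comm, prod_add_pow_div_qPoch hq hx hy0, sum_mul]
    refine sum_congr rfl fun j hj => ?_
    have hj' : j + (n - j) = n := by have := mem_range.1 hj; omega
    simp only [f, hj']
    ring
  rw [tsum_congr h1, tsum_sum_range_eq_tsum_tsum hf]
  refine tsum_congr fun j => ?_
  have ht : ‖-y * q ^ (j + 1)‖ < 1 := by
    rw [norm_mul, norm_neg, norm_pow]
    exact (mul_le_of_le_one_left (by positivity) hy).trans_lt
      (pow_lt_one₀ (norm_nonneg q) hq (Nat.succ_ne_zero j))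
  -- Splitting the triangular number of j + m leaves the cross term q^(jm), so the sum over m is
  -- Euler's series at t = -y q^(j+1).
  rw [← tsum_euler hq ht, ← triangle_add_triangle, pow_add, ← tsum_mul_left, ← tsum_mul_right,
    ← tsum_mul_right]
  refine tsum_congr fun m => ?_
  simp only [f]
  rw [triangle_add, triangle_eq_choose_add m, neg_mul, neg_neg, mul_pow]
  ring

/-! ### The functional equation and its telescoping -/

/-- The generating function whose values at `y q ^ k` are telescoped in
`tsum_shiftedProd_eq_double`. -/
noncomputable def telescopeFun (q x y z : ℂ) : ℂ :=
  ∑' j : ℕ, q ^ (j * (j + 1)) * qPochInf (-y * q ^ (j + 1)) q * (qPoch (x * q) q j)⁻¹ *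
    qBinomPartial q x z j

theorem norm_telescopeFun_term_le (hq : ‖q‖ < 1) (hx : ‖x‖ ≤ 1) (hy : ‖y‖ ≤ 1) {z : ℂ}
    (hz : ‖z‖ ≤ 1) (j : ℕ) :
    ‖q ^ (j * (j + 1)) * qPochInf (-y * q ^ (j + 1)) q * (qPoch (x * q) q j)⁻¹ *
      qBinomPartial q x z j‖ ≤
      ((1 - ‖q‖)⁻¹ * (qBound q * qBound q) * (qBound q * qBound q)) * ‖q‖ ^ j := by
  have hb := qBound_nonneg q
  have hr : 0 < 1 - ‖q‖ := sub_pos.2 hq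
  have e : q ^ (j * (j + 1)) * qPochInf (-y * q ^ (j + 1)) q * (qPoch (x * q) q j)⁻¹ *
      qBinomPartial q x z j = q ^ (j * j) * qBinomPartial q x z j *
        (qPochInf (-y * q ^ (j + 1)) q * (qPoch (x * q) q j)⁻¹) * q ^ j := by ring
  rw [e, norm_mul, norm_mul, norm_mul (qPochInf _ _), norm_pow q j]
  gcongr
  · exact norm_pow_mul_qBinomPartial_le hq hx hz (Nat.le_mul_self j)
  · exact norm_qPochInf_le hq (norm_mul_pow_le_one hq (by simpa using hy) _)
  · exact norm_inv_qPoch_mul_le hq hx j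

theorem summable_telescopeFun (hq : ‖q‖ < 1) (hx : ‖x‖ ≤ 1) (hy : ‖y‖ ≤ 1) {z : ℂ}
    (hz : ‖z‖ ≤ 1) : Summable fun j : ℕ =>
      q ^ (j * (j + 1)) * qPochInf (-y * q ^ (j + 1)) q * (qPoch (x * q) q j)⁻¹ *
        qBinomPartial q x z j :=
  summable_of_norm_le_geometric (norm_nonneg q) hq (norm_telescopeFun_term_le hq hx hy hz)

/-- Termwise from `qBinomPartial_functional`. The boundary term contains (x)_(j+1) = (1 - x) (xq)_j,
which cancels 1/(xq)_j and leaves a series depending on x only through 1 - x. -/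
theorem telescopeFun_functional (hq : ‖q‖ < 1) (hx : ‖x‖ ≤ 1) (hy : ‖y‖ ≤ 1) {z : ℂ}
    (hz : ‖z‖ ≤ 1) :
    (1 + z) * telescopeFun q x y z - (1 + x * z) * telescopeFun q x y (z * q) =
      (1 - x) * z * ∑' j : ℕ, (-z) ^ j * q ^ (j * (j + 1)) * qPochInf (-y * q ^ (j + 1)) q *
        (qPoch q q j)⁻¹ := by
  have hzq : ‖z * q‖ ≤ 1 := by simpa using norm_mul_pow_le_one hq hz 1
  have h1 := (summable_telescopeFun hq hx hy hz).mul_left (1 + z)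
  have h2 := (summable_telescopeFun hq hx hy hzq).mul_left (1 + x * z)
  rw [telescopeFun, telescopeFun, ← tsum_mul_left, ← tsum_mul_left, ← tsum_mul_left,
    ← h1.tsum_sub h2]
  refine tsum_congr fun j => ?_
  have h3 := qPoch_mul_ne_zero hq hx j
  have h4 := qBinomPartial_functional hq x z j
  -- The variable d does not occur in the equation; the 0 passed below merely fills its place.
  have e : ∀ c d s t : ℂ, (1 + z) * (c * s) - (1 + x * z) * (c * t) =
      c * ((1 + z) * s - (1 + x * z) * t) := fun c d s t => by ring
  rw [e _ 0, h4, qPoch_succ']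
  field_simp

theorem tendsto_telescopeFun (hq : ‖q‖ < 1) (hx : ‖x‖ ≤ 1) (hy : ‖y‖ ≤ 1) :
    Filter.Tendsto (fun k : ℕ => telescopeFun q x y (y * q ^ k)) Filter.atTop
      (nhds (∑' j : ℕ, q ^ (j * (j + 1)) * qPochInf (-y * q ^ (j + 1)) q *
        (qPoch (x * q) q j)⁻¹)) := by
  refine tendsto_tsum_of_dominated_convergence
    ((summable_geometric_of_lt_one (norm_nonneg q) hq).mul_left _) (fun j => ?_)
    (Filter.Eventually.of_forall fun k =>
      norm_telescopeFun_term_le hq hx hy (norm_mul_pow_le_one hq hy k))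
  have h0 : qBinomPartial q x 0 j = 1 := by
    rw [qBinomPartial, sum_range_succ']
    simp [qPoch_zero]
  have h1 : Filter.Tendsto (fun k : ℕ => y * q ^ k) Filter.atTop (nhds 0) := by
    simpa using (tendsto_pow_atTop_nhds_zero_of_norm_lt_one hq).const_mul y
  have h2 : Continuous fun z => qBinomPartial q x z j := by
    unfold qBinomPartial
    fun_prop
  have h3 := (h2.tendsto 0).comp h1
  rw [h0] at h3
  simpa using h3.const_mul _

theorem qPochInf_neg_mul_pow (hq : ‖q‖ < 1) (hy : ‖y‖ ≤ 1) (hy1 : 1 + y ≠ 0) (j : ℕ) :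
    qPochInf (-y * q ^ (j + 1)) q = qPochInf (-y) q * (qPoch (-y) q (j + 1))⁻¹ := by
  have := qPoch_neg_ne_zero hq hy hy1 (j + 1)
  rw [qPochInf_eq_mul (-y) hq (j + 1)]
  field_simp

/-- At z = y q^k the coefficients 1 + z and 1 + xz of the functional equation are the next factors
of (-y)_k and (-xy)_k, so the weights turn it into a difference of consecutive terms. -/
theorem telescopeFun_sub_eq (hq : ‖q‖ < 1) (hx : ‖x‖ ≤ 1) (hy : ‖y‖ ≤ 1) (hy1 : 1 + y ≠ 0)
    (k : ℕ) :
    qPoch (-(x * y)) q k / qPoch (-y) q k * telescopeFun q x y (y * q ^ k) -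
      qPoch (-(x * y)) q (k + 1) / qPoch (-y) q (k + 1) *
        telescopeFun q x y (y * q ^ (k + 1)) =
    (1 - x) * y * qPochInf (-y) q * ∑' j : ℕ,
      (-1) ^ j * y ^ j * q ^ (j * (j + 1)) / (qPoch q q j * qPoch (-y) q (j + 1)) *
        (qPoch (-(x * y)) q k / qPoch (-y) q (k + 1) * q ^ ((j + 1) * k)) := by
  have hfin := qPoch_neg_ne_zero hq hy hy1
  have h1 := telescopeFun_functional hq hx hy (norm_mul_pow_le_one hq hy k)
  have h2 := hfin (k + 1)
  have h3 := hfin k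
  have h4 : 1 - -y * q ^ k ≠ 0 := by
    rw [qPoch_succ] at h2; exact right_ne_zero_of_mul h2
  have e : qPoch (-(x * y)) q k / qPoch (-y) q k * telescopeFun q x y (y * q ^ k) -
      qPoch (-(x * y)) q (k + 1) / qPoch (-y) q (k + 1) *
        telescopeFun q x y (y * q ^ (k + 1)) =
      qPoch (-(x * y)) q k / qPoch (-y) q (k + 1) *
        ((1 + y * q ^ k) * telescopeFun q x y (y * q ^ k) - (1 + x * (y * q ^ k)) *
          telescopeFun q x y (y * q ^ k * q)) := by
    rw [mul_assoc y, ← pow_succ, qPoch_succ, qPoch_succ,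
      show 1 + y * q ^ k = 1 - -y * q ^ k by ring]
    generalize 1 - -y * q ^ k = d at *
    field_simp
    ring
  rw [e, h1, ← tsum_mul_left, ← tsum_mul_left, ← tsum_mul_left]
  refine tsum_congr fun j => ?_
  rw [qPochInf_neg_mul_pow hq hy hy1, neg_pow, mul_pow, ← pow_mul, add_mul, one_mul, pow_add q (j * k),
    mul_comm j k, div_eq_mul_inv, div_eq_mul_inv, mul_inv]
  ring

/-- The transformation of `∑ (y + q) ⋯ (y + q ^ n) q ^ (n (n + 1) / 2) / (x q; q)_n` into a single
and a double series. -/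
theorem tsum_shiftedProd_eq_double (hq : ‖q‖ < 1) (hx : ‖x‖ ≤ 1) (hy : ‖y‖ ≤ 1) (hy0 : y ≠ 0)
    (hy1 : 1 + y ≠ 0) :
    qPochInf (-(x * y)) q / qPochInf (-y) q *
        ∑' n : ℕ, q ^ (n * (n + 1)) / (qPoch (-y) q (n + 1) * qPoch (x * q) q n) +
      (1 - x) * y *
        ∑' n : ℕ, (-1) ^ n * y ^ n * q ^ (n * (n + 1)) / (qPoch q q n * qPoch (-y) q (n + 1)) *
          ∑' k : ℕ, qPoch (-(x * y)) q k / qPoch (-y) q (k + 1) * q ^ ((n + 1) * k) =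
      (qPochInf (-y) q)⁻¹ *
        ∑' n : ℕ, shiftedProd y q n * q ^ (n * (n + 1) / 2) * (qPoch (x * q) q n)⁻¹ := by
  have hb := qBound_nonneg q
  have hinf := qPochInf_neg_ne_zero hq hy hy1
  have hfin := qPoch_neg_ne_zero hq hy hy1
  have hsplit := qPochInf_neg_mul_pow hq hy hy1
  have hG := summable_double hq hx hy (by positivity) (norm_double_coeff_le hq hy)
  have hstep := telescopeFun_sub_eq hq hx hy hy1
  have hGs : Summable fun k : ℕ => ∑' j : ℕ,
        (-1) ^ j * y ^ j * q ^ (j * (j + 1)) / (qPoch q q j * qPoch (-y) q (j + 1)) *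
          (qPoch (-(x * y)) q k / qPoch (-y) q (k + 1) * q ^ ((j + 1) * k)) := hG.prod_symm.prod
  have hlim : Filter.Tendsto (fun k : ℕ =>
      qPoch (-(x * y)) q k / qPoch (-y) q k * telescopeFun q x y (y * q ^ k)) Filter.atTop
      (nhds (qPochInf (-(x * y)) q / qPochInf (-y) q *
        ∑' j : ℕ, q ^ (j * (j + 1)) * qPochInf (-y * q ^ (j + 1)) q *
        (qPoch (x * q) q j)⁻¹)) :=
    ((tendsto_qPoch _ hq).div (tendsto_qPoch _ hq) hinf).mul (tendsto_telescopeFun hq hx hy)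
  -- The term at k = 0 is L(y) and the limit is the single series; the sum of the differences is the
  -- double series with k outermost, hence the interchange that follows.
  have hsum := tsum_sub_succ_eq hlim
    (((hGs.mul_left ((1 - x) * y * qPochInf (-y) q))).congr fun k => (hstep k).symm)
  have hcomm : ∑' k : ℕ, ∑' j : ℕ,
        (-1) ^ j * y ^ j * q ^ (j * (j + 1)) / (qPoch q q j * qPoch (-y) q (j + 1)) *
          (qPoch (-(x * y)) q k / qPoch (-y) q (k + 1) * q ^ ((j + 1) * k)) =
      ∑' n : ℕ, (-1) ^ n * y ^ n * q ^ (n * (n + 1)) / (qPoch q q n * qPoch (-y) q (n + 1)) *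
          ∑' k : ℕ, qPoch (-(x * y)) q k / qPoch (-y) q (k + 1) * q ^ ((n + 1) * k) :=
    tsum_tsum_mul_comm hG
  rw [tsum_congr hstep, tsum_mul_left, hcomm] at hsum
  have hT0 : qPoch (-(x * y)) q 0 / qPoch (-y) q 0 * telescopeFun q x y (y * q ^ 0) =
      ∑' n : ℕ, shiftedProd y q n * q ^ (n * (n + 1) / 2) * (qPoch (x * q) q n)⁻¹ := by
    rw [tsum_shiftedProd_eq_tsum_qBinomPartial hq hx hy hy0, telescopeFun]
    simp [qPoch_zero]
  have hB : ∑' j : ℕ, q ^ (j * (j + 1)) * qPochInf (-y * q ^ (j + 1)) q *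
        (qPoch (x * q) q j)⁻¹ = qPochInf (-y) q *
        ∑' n : ℕ, q ^ (n * (n + 1)) / (qPoch (-y) q (n + 1) * qPoch (x * q) q n) := by
    rw [← tsum_mul_left]
    refine tsum_congr fun j => ?_
    rw [hsplit, div_eq_mul_inv, mul_inv]
    ring
  rw [hT0, hB] at hsum
  generalize (∑' n : ℕ, shiftedProd y q n * q ^ (n * (n + 1) / 2) * (qPoch (x * q) q n)⁻¹) = L
    at *
  rw [eq_comm, sub_eq_iff_eq_add] at hsum
  rw [hsum]
  field_simp
  ring

/-- The evaluation of `∑ (y + q) ⋯ (y + q ^ n) q ^ (n (n + 1) / 2) / (x q; q)_n` by Andrews'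
Bailey pair. -/
theorem tsum_andrewsA_eq (hq0 : q ≠ 0) (hq : ‖q‖ < 1) (hx : ‖x‖ ≤ 1) (hy : ‖y‖ ≤ 1) (hy0 : y ≠ 0)
    (hy1 : 1 + y ≠ 0) :
    (qPochInf (q ^ 2) q)⁻¹ * ∑' n : ℕ, shiftedProd y q n * q ^ (n * (n + 1) / 2) *
        andrewsA 1 q x n / qPoch (-y) q (n + 1) =
      (qPochInf (-y) q)⁻¹ *
        ∑' n : ℕ, shiftedProd y q n * q ^ (n * (n + 1) / 2) * (qPoch (x * q) q n)⁻¹ := by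
  have hb := qBound_nonneg q
  have hinf := qPochInf_neg_ne_zero hq hy hy1
  have hq' : 1 - q ≠ 0 := by simpa using one_sub_pow_ne_zero hq one_ne_zero
  have hqinf := qPochInf_self_ne_zero hq
  have hq2 : qPochInf q q = (1 - q) * qPochInf (q ^ 2) q := by
    rw [qPochInf_eq_mul q hq 1, qPoch_one]; ring_nf
  obtain ⟨K, hK0, hK⟩ := norm_one_sub_mul_andrewsA_le hq0 hq hx
  let f : ℕ × ℕ → ℂ := fun p => shiftedProd y q (p.1 + p.2) *
    q ^ ((p.1 + p.2) * (p.1 + p.2 + 1) / 2) * ((1 - q) * andrewsA 1 q x p.1) *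
      ((qPoch q q p.2)⁻¹ * (qPoch q q (p.1 + p.2 + p.1 + 1))⁻¹)
  have hf : Summable f := by
    refine summable_prod_of_norm_le_geometric
      (C := qBound q * K * (qBound q * qBound q)) (norm_nonneg q) hq fun j m => ?_
    simp only [f]
    rw [norm_mul, norm_mul, norm_mul, norm_mul _⁻¹]
    calc _ ≤ qBound q * ‖q‖ ^ (j + m) * K * (qBound q * qBound q) := by
          gcongr
          · exact norm_shiftedProd_le hq hy _
          · exact norm_pow_le_pow hq (le_triangle _)
          · exact hK j
          · exact norm_inv_qPoch_self_le hq _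
          · exact norm_inv_qPoch_self_le hq _
      _ = _ := by rw [pow_add]; ring
  have h1 : ∀ n : ℕ, shiftedProd y q n * q ^ (n * (n + 1) / 2) * (qPoch (x * q) q n)⁻¹ =
      ∑ j ∈ range (n + 1), f (j, n - j) := by
    intro n
    rw [← sum_andrewsA_eq hq0 hq hx, mul_sum]
    refine sum_congr rfl fun j hj => ?_
    have hj' : j + (n - j) = n := by have := mem_range.1 hj; omega
    simp only [f, hj']
    ring
  rw [tsum_congr h1, tsum_sum_range_eq_tsum_tsum hf, ← tsum_mul_left, ← tsum_mul_left]
  refine tsum_congr fun j => ?_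
  have ht : ‖-y * q ^ (j + 1)‖ < 1 := by
    rw [norm_mul, norm_neg, norm_pow]
    exact (mul_le_of_le_one_left (by positivity) hy).trans_lt
      (pow_lt_one₀ (norm_nonneg q) hq (Nat.succ_ne_zero j))
  -- With a = -q^(j+1)/y and t = -y q^(j+1), the product at = q^(2j+2) is free of y, so (at q^m)_∞
  -- is exactly (q)_∞ / (q)_(2j+m+1), the second factorial of the Bailey relation.
  have h2 : ∑' m : ℕ, f (j, m) = shiftedProd y q j * q ^ (j * (j + 1) / 2) *
      ((1 - q) * andrewsA 1 q x j) * (qPochInf q q)⁻¹ * qPochInf (-y * q ^ (j + 1)) q := by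
    rw [← tsum_one_phi_one hq ht (-q ^ (j + 1) / y), ← tsum_mul_left]
    refine tsum_congr fun m => ?_
    have h3 : qPochInf (-q ^ (j + 1) / y * (-y * q ^ (j + 1)) * q ^ m) q =
        qPochInf q q * (qPoch q q (j + m + j + 1))⁻¹ := by
      have := qPoch_self_ne_zero hq (j + m + j + 1)
      rw [qPochInf_eq_mul q hq (j + m + j + 1)]
      field_simp
      ring_nf
    rw [h3]
    simp only [f]
    rw [shiftedProd_add y q hy0, triangle_add, triangle_eq_choose_add m, neg_mul, neg_neg,
      mul_pow]
    field_simp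
    ring
  have hfin := qPoch_neg_ne_zero hq hy hy1 (j + 1)
  have h4 : qPochInf (-y) q = qPoch (-y) q (j + 1) * qPochInf (-y * q ^ (j + 1)) q :=
    qPochInf_eq_mul (-y) hq (j + 1)
  have h5 : qPochInf (-y * q ^ (j + 1)) q ≠ 0 := by
    rw [h4] at hinf; exact right_ne_zero_of_mul hinf
  have h6 : qPochInf (q ^ 2) q ≠ 0 := by
    rw [hq2] at hqinf; exact right_ne_zero_of_mul hqinf
  rw [h2, h4, hq2]
  generalize qPochInf (-y * q ^ (j + 1)) q = P at h5 ⊢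
  field_simp

end Main

/-! ### Product identities -/

theorem shiftedProd_one (q : ℂ) (n : ℕ) : shiftedProd 1 q n = qPoch (-q) q n := by
  refine prod_congr rfl fun i _ => ?_
  ring

/-- For y^2 = q one has q/y = y, so the numerator repeats the factors of (-y)_(n+1). In the Bailey
series this cancels everything but 1 + q^(n+1/2). -/
theorem shiftedProd_sqrt (h : ℂ) (n : ℕ) :
    shiftedProd h (h ^ 2) n = h ^ n * qPoch (-h) (h ^ 2) n := by
  rw [shiftedProd, qPoch, ← card_range n, ← prod_const, card_range, ← prod_mul_distrib]
  refine prod_congr rfl fun i _ => ?_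
  ring

theorem qPoch_neg_one_succ (q : ℂ) (n : ℕ) : qPoch (-1) q (n + 1) = 2 * qPoch (-q) q n := by
  rw [qPoch_succ', neg_one_mul]
  norm_num

theorem qPochInf_neg_one {q : ℂ} (hq : ‖q‖ < 1) : qPochInf (-1) q = 2 * qPochInf (-q) q := by
  rw [qPochInf_eq_mul _ hq 1, qPoch_one, pow_one, neg_one_mul]
  norm_num

theorem qPoch_mul_qPoch_neg (q : ℂ) (n : ℕ) :
    qPoch q q n * qPoch (-q) q n = qPoch (q ^ 2) (q ^ 2) n := by
  rw [qPoch, qPoch, qPoch, ← prod_mul_distrib]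
  refine prod_congr rfl fun i _ => ?_
  ring

theorem qPoch_two_mul_add_one (w q : ℂ) (n : ℕ) :
    qPoch w q (2 * n + 1) = qPoch w (q ^ 2) (n + 1) * qPoch (w * q) (q ^ 2) n := by
  induction n with
  | zero => simp [qPoch_one, qPoch_zero]
  | succ n ih =>
    rw [show 2 * (n + 1) + 1 = 2 * n + 1 + 1 + 1 by ring, qPoch_succ, qPoch_succ, ih,
      qPoch_succ w (q ^ 2) (n + 1), qPoch_succ (w * q)]
    ring

theorem one_add_ne_zero_of_norm_lt_one {q : ℂ} (hq : ‖q‖ < 1) : 1 + q ≠ 0 := by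
  simpa using one_sub_mul_pow_ne_zero (w := -1) hq (by simp) one_ne_zero

theorem norm_sq_lt_one {q : ℂ} (hq : ‖q‖ < 1) : ‖q ^ 2‖ < 1 := by
  rw [norm_pow]
  exact pow_lt_one₀ (norm_nonneg q) hq two_ne_zero

section Identities

variable {q : ℂ}

/-! ### The case `y = 1` -/

theorem bailey_identity_one (hq0 : q ≠ 0) (hq1 : ‖q‖ < 1) {x : ℂ} (hx : ‖x‖ ≤ 1) :
    (Summable fun n : ℕ => q ^ (n * (n + 1)) / (qPoch (-q) q n * qPoch (x * q) q n)) ∧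
      (∀ n : ℕ, Summable fun k : ℕ =>
        qPoch (-x) q k / qPoch (-q) q k * q ^ ((n + 1) * k)) ∧
      (Summable fun n : ℕ => (-1) ^ n * q ^ (n * (n + 1)) / qPoch (q ^ 2) (q ^ 2) n *
        ∑' k : ℕ, qPoch (-x) q k / qPoch (-q) q k * q ^ ((n + 1) * k)) ∧
      (Summable fun n : ℕ => q ^ (n * (n + 1) / 2) * andrewsA 1 q x n) ∧
      (Summable fun n : ℕ => qPoch (-q) q n / qPoch (x * q) q n * q ^ (n * (n + 1) / 2)) ∧
      1 / 2 * (qPochInf (-x) q / qPochInf (-q) q) *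
          ∑' n : ℕ, q ^ (n * (n + 1)) / (qPoch (-q) q n * qPoch (x * q) q n) +
        (1 - x) * (1 / 2) *
          ∑' n : ℕ, (-1) ^ n * q ^ (n * (n + 1)) / qPoch (q ^ 2) (q ^ 2) n *
            ∑' k : ℕ, qPoch (-x) q k / qPoch (-q) q k * q ^ ((n + 1) * k) =
        1 / qPochInf (q ^ 2) q * ∑' n : ℕ, q ^ (n * (n + 1) / 2) * andrewsA 1 q x n ∧
      1 / qPochInf (q ^ 2) q * ∑' n : ℕ, q ^ (n * (n + 1) / 2) * andrewsA 1 q x n =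
        1 / qPochInf (-q) q *
          ∑' n : ℕ, qPoch (-q) q n / qPoch (x * q) q n * q ^ (n * (n + 1) / 2) := by
  have hy : ‖(1 : ℂ)‖ ≤ 1 := by simp
  have hy1 : (1 : ℂ) + 1 ≠ 0 := by norm_num
  have e1 : ∀ n : ℕ, q ^ (n * (n + 1)) / (qPoch (-q) q n * qPoch (x * q) q n) =
      2 * (q ^ (n * (n + 1)) / (qPoch (-1) q (n + 1) * qPoch (x * q) q n)) := by
    intro n
    rw [qPoch_neg_one_succ]
    simp only [div_eq_mul_inv, mul_inv]
    ring
  have e2 : ∀ n k : ℕ, qPoch (-x) q k / qPoch (-q) q k * q ^ ((n + 1) * k) =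
      2 * (qPoch (-(x * 1)) q k / qPoch (-1) q (k + 1) * q ^ ((n + 1) * k)) := by
    intro n k
    rw [qPoch_neg_one_succ, mul_one]
    simp only [div_eq_mul_inv, mul_inv]
    ring
  -- Passing from (-1)_(m+1) to 2 (-q)_m costs a factor 2 in each of the outer and the inner
  -- denominators, hence the 4.
  have e3 : ∀ n : ℕ, (-1) ^ n * q ^ (n * (n + 1)) / qPoch (q ^ 2) (q ^ 2) n *
        ∑' k : ℕ, qPoch (-x) q k / qPoch (-q) q k * q ^ ((n + 1) * k) =
      4 * ((-1) ^ n * 1 ^ n * q ^ (n * (n + 1)) / (qPoch q q n * qPoch (-1) q (n + 1)) *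
        ∑' k : ℕ, qPoch (-(x * 1)) q k / qPoch (-1) q (k + 1) * q ^ ((n + 1) * k)) := by
    intro n
    rw [tsum_congr (e2 n), tsum_mul_left, qPoch_neg_one_succ, ← qPoch_mul_qPoch_neg, one_pow]
    simp only [div_eq_mul_inv, mul_inv]
    ring
  have e4 : ∀ n : ℕ, q ^ (n * (n + 1) / 2) * andrewsA 1 q x n =
      2 * (shiftedProd 1 q n * q ^ (n * (n + 1) / 2) * andrewsA 1 q x n /
        qPoch (-1) q (n + 1)) := by
    intro n
    have := qPoch_mul_ne_zero (w := -1) hq1 (by simp) n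
    rw [neg_one_mul] at this
    rw [qPoch_neg_one_succ, shiftedProd_one]
    field_simp
  have e5 : ∀ n : ℕ, qPoch (-q) q n / qPoch (x * q) q n * q ^ (n * (n + 1) / 2) =
      shiftedProd 1 q n * q ^ (n * (n + 1) / 2) * (qPoch (x * q) q n)⁻¹ := by
    intro n
    rw [shiftedProd_one]
    ring
  have hinf : qPochInf (-q) q ≠ 0 := by
    simpa using qPochInf_mul_ne_zero (w := -1) hq1 (by simp)
  have m1 := tsum_shiftedProd_eq_double hq1 hx hy one_ne_zero hy1
  have m2 := tsum_andrewsA_eq hq0 hq1 hx hy one_ne_zero hy1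
  have r2 : 1 / qPochInf (q ^ 2) q * ∑' n : ℕ, q ^ (n * (n + 1) / 2) * andrewsA 1 q x n =
        1 / qPochInf (-q) q *
          ∑' n : ℕ, qPoch (-q) q n / qPoch (x * q) q n * q ^ (n * (n + 1) / 2) := by
    rw [tsum_congr e4, tsum_congr e5, tsum_mul_left, one_div, mul_left_comm, m2,
      qPochInf_neg_one hq1, mul_inv, one_div]
    ring
  refine ⟨((summable_pow_div_qPoch_mul hq1 hx hy).mul_left 2).congr fun n => (e1 n).symm,
    fun n => ((summable_qPoch_div_mul_pow hq1 hx hy n).mul_left 2).congr fun k => (e2 n k).symm,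
    ((summable_double_outer hq1 hx hy).mul_left 4).congr fun n => (e3 n).symm,
    ((summable_andrewsA hq0 hq1 hx hy).mul_left 2).congr fun n => (e4 n).symm,
    (summable_shiftedProd hq1 hx hy).congr fun n => (e5 n).symm, ?_, r2⟩
  rw [r2, tsum_congr e1, tsum_congr e3, tsum_congr e5, tsum_mul_left, tsum_mul_left]
  rw [qPochInf_neg_one hq1, mul_inv, mul_one x] at m1
  simp only [mul_one] at m1 ⊢
  rw [one_div (qPochInf _ _)]
  linear_combination (norm := skip) 2 * m1
  simp only [div_eq_mul_inv, mul_inv]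
  ring

theorem bailey_identity_one_zero (hq0 : q ≠ 0) (hq1 : ‖q‖ < 1) :
    (Summable fun n : ℕ => q ^ (n * (n + 1)) / qPoch (-q) q n) ∧
      (Summable fun n : ℕ => q ^ n * qPochInf (q ^ (n + 2)) (q ^ 2) / qPoch (-q) q n) ∧
      (Summable fun n : ℕ => qPoch (-q) q n * q ^ (n * (n + 1) / 2)) ∧
      1 / (2 * qPochInf (-q) q) * ∑' n : ℕ, q ^ (n * (n + 1)) / qPoch (-q) q n +
        1 / 2 * ∑' n : ℕ, q ^ n * qPochInf (q ^ (n + 2)) (q ^ 2) / qPoch (-q) q n =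
        1 / qPochInf (-q) q * ∑' n : ℕ, qPoch (-q) q n * q ^ (n * (n + 1) / 2) := by
  have hx : ‖(0 : ℂ)‖ ≤ 1 := by simp
  have hy : ‖(1 : ℂ)‖ ≤ 1 := by simp
  have hq2 := norm_sq_lt_one hq1
  obtain ⟨s1, -, -, -, s5, m1, m2⟩ := bailey_identity_one hq0 hq1 hx
  rw [m2] at m1
  simp only [zero_mul, neg_zero, qPoch_zero_left, qPochInf_zero_left, mul_one, div_one, sub_zero,
    one_mul] at s1 s5 m1
  have hb : ∀ n : ℕ, ‖(-1) ^ n * q ^ (n * (n + 1)) / qPoch (q ^ 2) (q ^ 2) n‖ ≤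
      qBound (q ^ 2) * ‖q‖ ^ n := by
    intro n
    have := qBound_nonneg (q ^ 2)
    rw [div_eq_mul_inv, norm_mul, norm_mul, norm_pow (-1), norm_neg, norm_one, one_pow, one_mul,
      mul_comm]
    gcongr
    · exact norm_inv_qPoch_self_le hq2 n
    · exact norm_pow_le_pow hq1 (Nat.le_mul_of_pos_right n n.succ_pos)
  have hG := (summable_double (x := 0) hq1 hx hy (qBound_nonneg _) hb).mul_left 2
  have hG' : Summable fun p : ℕ × ℕ => (-1) ^ p.1 * q ^ (p.1 * (p.1 + 1)) /
      qPoch (q ^ 2) (q ^ 2) p.1 * (1 / qPoch (-q) q p.2 * q ^ ((p.1 + 1) * p.2)) := by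
    refine hG.congr fun p => ?_
    rw [zero_mul, neg_zero, qPoch_zero_left, qPoch_neg_one_succ]
    simp only [div_eq_mul_inv, mul_inv]
    ring
  -- At x = 0 the order of summation is reversed: for fixed k the sum over j is Euler's series in
  -- base q^2 at t = q^(k+2).
  have hin : ∀ k : ℕ, ∑' j : ℕ, (-1) ^ j * q ^ (j * (j + 1)) / qPoch (q ^ 2) (q ^ 2) j *
      (1 / qPoch (-q) q k * q ^ ((j + 1) * k)) =
      q ^ k * qPochInf (q ^ (k + 2)) (q ^ 2) / qPoch (-q) q k := by
    intro k
    have ht : ‖q ^ (k + 2)‖ < 1 := by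
      rw [norm_pow]
      exact pow_lt_one₀ (norm_nonneg q) hq1 (by omega)
    rw [← tsum_euler hq2 ht, ← tsum_mul_left, ← tsum_div_const]
    refine tsum_congr fun j => ?_
    have e : q ^ (j * (j + 1)) = (q ^ 2) ^ j.choose 2 * (q ^ 2) ^ j := by
      rw [← triangle_add_triangle, triangle_eq_choose_add]
      ring
    rw [e, neg_pow]
    ring
  have hcomm := tsum_tsum_mul_comm
    (b := fun n => (-1) ^ n * q ^ (n * (n + 1)) / qPoch (q ^ 2) (q ^ 2) n)
    (w := fun n k => 1 / qPoch (-q) q k * q ^ ((n + 1) * k)) hG'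
  rw [tsum_congr hin] at hcomm
  refine ⟨s1, hG'.prod_symm.prod.congr hin, s5, ?_⟩
  rw [hcomm, ← m1]
  simp only [div_eq_mul_inv, mul_inv]
  ring

theorem bailey_identity_one_neg_sqrt (hq0 : q ≠ 0) (hq1 : ‖q‖ < 1) :
    (Summable fun n : ℕ => q ^ (2 * n * (n + 1)) / qPoch (-q) q (2 * n + 1)) ∧
      (∀ n : ℕ, Summable fun k : ℕ =>
        qPoch q (q ^ 2) k / qPoch (-q ^ 2) (q ^ 2) k * q ^ (2 * (n + 1) * k)) ∧
      (Summable fun n : ℕ => (-1) ^ n * q ^ (2 * n * (n + 1)) / qPoch (q ^ 4) (q ^ 4) n *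
        ∑' k : ℕ, qPoch q (q ^ 2) k / qPoch (-q ^ 2) (q ^ 2) k * q ^ (2 * (n + 1) * k)) ∧
      (Summable fun n : ℕ =>
        qPoch (-q ^ 2) (q ^ 2) n / qPoch (-q) (q ^ 2) (n + 1) * q ^ (n * (n + 1))) ∧
      1 / 2 * (qPochInf q (q ^ 2) / qPochInf (-q ^ 2) (q ^ 2)) *
          ∑' n : ℕ, q ^ (2 * n * (n + 1)) / qPoch (-q) q (2 * n + 1) +
        1 / 2 *
          ∑' n : ℕ, (-1) ^ n * q ^ (2 * n * (n + 1)) / qPoch (q ^ 4) (q ^ 4) n *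
            ∑' k : ℕ, qPoch q (q ^ 2) k / qPoch (-q ^ 2) (q ^ 2) k * q ^ (2 * (n + 1) * k) =
        1 / qPochInf (-q ^ 2) (q ^ 2) *
          ∑' n : ℕ,
            qPoch (-q ^ 2) (q ^ 2) n / qPoch (-q) (q ^ 2) (n + 1) * q ^ (n * (n + 1)) := by
  have hq := one_add_ne_zero_of_norm_lt_one hq1
  obtain ⟨s1, s2, s3, -, s5, m1, m2⟩ := bailey_identity_one (x := -q) (pow_ne_zero 2 hq0)
    (norm_sq_lt_one hq1) (by simpa using hq1.le)
  rw [m2] at m1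
  -- The odd and even powers in (-q)_(2n+1) separate into two products in base q^2. The extra factor
  -- 1 + q is 1 - x at x = -q, so it cancels the prefactor of the double series.
  have e1 : ∀ n : ℕ, q ^ (2 * n * (n + 1)) / qPoch (-q) q (2 * n + 1) = (1 + q)⁻¹ *
      ((q ^ 2) ^ (n * (n + 1)) / (qPoch (-q ^ 2) (q ^ 2) n * qPoch (-q * q ^ 2) (q ^ 2) n)) := by
    intro n
    rw [qPoch_two_mul_add_one, qPoch_succ', ← pow_mul, sub_neg_eq_add, mul_assoc 2,
      show -q * q = -q ^ 2 by ring]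
    simp only [div_eq_mul_inv, mul_inv]
    ring
  have e5 : ∀ n : ℕ, qPoch (-q ^ 2) (q ^ 2) n / qPoch (-q) (q ^ 2) (n + 1) * q ^ (n * (n + 1)) =
      (1 + q)⁻¹ * (qPoch (-q ^ 2) (q ^ 2) n / qPoch (-q * q ^ 2) (q ^ 2) n *
        (q ^ 2) ^ (n * (n + 1) / 2)) := by
    intro n
    rw [qPoch_succ', ← pow_mul, sub_neg_eq_add, two_mul, triangle_add_triangle]
    simp only [div_eq_mul_inv, mul_inv]
    ring
  have e3 : ∀ m : ℕ, (q ^ 2) ^ m = q ^ (2 * m) := fun m => (pow_mul q 2 m).symm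
  refine ⟨(s1.mul_left _).congr fun n => (e1 n).symm, ?_, ?_,
    (s5.mul_left _).congr fun n => (e5 n).symm, ?_⟩
  · simpa only [neg_neg, e3, mul_assoc] using s2
  · simpa only [neg_neg, e3, mul_assoc, show 2 * 2 = 4 from rfl] using s3
  · rw [tsum_congr e1, tsum_congr e5, tsum_mul_left, tsum_mul_left, mul_left_comm _ (1 + q)⁻¹,
      mul_left_comm _ (1 + q)⁻¹, ← m1]
    simp only [neg_neg, e3, mul_assoc, show 2 * 2 = 4 from rfl, sub_neg_eq_add]
    field_simp

/-! ### The case `y ^ 2 = q` -/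

theorem bailey_identity_sqrt {h : ℂ} (hh0 : h ≠ 0) (hh1 : ‖h‖ < 1) (hh : h ^ 2 = q) {x : ℂ}
    (hx : ‖x‖ ≤ 1) :
    (Summable fun n : ℕ => q ^ (n * (n + 1)) / (qPoch (-h) q (n + 1) * qPoch (x * q) q n)) ∧
      (∀ n : ℕ, Summable fun k : ℕ =>
        qPoch (-x * h) q k / qPoch (-h) q (k + 1) * q ^ ((n + 1) * k)) ∧
      (Summable fun n : ℕ =>
        (-1) ^ n * h ^ (n * (2 * n + 3)) / (qPoch (-h) q (n + 1) * qPoch q q n) *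
            ∑' k : ℕ, qPoch (-x * h) q k / qPoch (-h) q (k + 1) * q ^ ((n + 1) * k)) ∧
      (Summable fun n : ℕ => h ^ (n ^ 2 + 2 * n) * andrewsA 1 q x n / (1 + h ^ (2 * n + 1))) ∧
      (Summable fun n : ℕ => qPoch (-h) q n / qPoch (x * q) q n * h ^ (n * (n + 2))) ∧
      qPochInf (-x * h) q / qPochInf (-h) q *
          ∑' n : ℕ, q ^ (n * (n + 1)) / (qPoch (-h) q (n + 1) * qPoch (x * q) q n) +
        (1 - x) * h *
          ∑' n : ℕ, (-1) ^ n * h ^ (n * (2 * n + 3)) / (qPoch (-h) q (n + 1) * qPoch q q n) *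
                ∑' k : ℕ, qPoch (-x * h) q k / qPoch (-h) q (k + 1) * q ^ ((n + 1) * k) =
        1 / qPochInf (-h) q *
          ∑' n : ℕ, qPoch (-h) q n / qPoch (x * q) q n * h ^ (n * (n + 2)) ∧
      1 / qPochInf (q ^ 2) q *
          ∑' n : ℕ, h ^ (n ^ 2 + 2 * n) * andrewsA 1 q x n / (1 + h ^ (2 * n + 1)) =
        1 / qPochInf (-h) q *
          ∑' n : ℕ, qPoch (-h) q n / qPoch (x * q) q n * h ^ (n * (n + 2)) := by
  subst hh
  have hq0 : h ^ 2 ≠ 0 := pow_ne_zero 2 hh0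
  have hq1 := norm_sq_lt_one hh1
  have hy1 := one_add_ne_zero_of_norm_lt_one hh1
  have e3 : ∀ (n : ℕ) (S : ℂ), (-1) ^ n * h ^ (n * (2 * n + 3)) /
        (qPoch (-h) (h ^ 2) (n + 1) * qPoch (h ^ 2) (h ^ 2) n) * S =
      (-1) ^ n * h ^ n * (h ^ 2) ^ (n * (n + 1)) /
        (qPoch (h ^ 2) (h ^ 2) n * qPoch (-h) (h ^ 2) (n + 1)) * S := by
    intro n S
    ring
  have e5 : ∀ n : ℕ, qPoch (-h) (h ^ 2) n / qPoch (x * h ^ 2) (h ^ 2) n * h ^ (n * (n + 2)) =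
      shiftedProd h (h ^ 2) n * (h ^ 2) ^ (n * (n + 1) / 2) *
        (qPoch (x * h ^ 2) (h ^ 2) n)⁻¹ := by
    intro n
    rw [shiftedProd_sqrt, ← pow_mul, two_mul, triangle_add_triangle]
    ring
  have e4 : ∀ n : ℕ, h ^ (n ^ 2 + 2 * n) * andrewsA 1 (h ^ 2) x n / (1 + h ^ (2 * n + 1)) =
      shiftedProd h (h ^ 2) n * (h ^ 2) ^ (n * (n + 1) / 2) * andrewsA 1 (h ^ 2) x n /
        qPoch (-h) (h ^ 2) (n + 1) := by
    intro n
    have h1 := qPoch_neg_ne_zero hq1 hh1.le hy1 (n + 1)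
    rw [qPoch_succ, show 1 - -h * (h ^ 2) ^ n = 1 + h ^ (2 * n + 1) by ring] at h1
    have h2 := left_ne_zero_of_mul h1
    have h3 := right_ne_zero_of_mul h1
    rw [shiftedProd_sqrt, ← pow_mul, two_mul (n * (n + 1) / 2), triangle_add_triangle, qPoch_succ,
      show 1 - -h * (h ^ 2) ^ n = 1 + h ^ (2 * n + 1) by ring]
    generalize 1 + h ^ (2 * n + 1) = d at *
    field_simp
    ring
  have m1 := tsum_shiftedProd_eq_double hq1 hx hh1.le hh0 hy1
  have m2 := tsum_andrewsA_eq hq0 hq1 hx hh1.le hh0 hy1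
  refine ⟨summable_pow_div_qPoch_mul hq1 hx hh1.le, ?_, ?_,
    (summable_andrewsA hq0 hq1 hx hh1.le).congr fun n => (e4 n).symm,
    (summable_shiftedProd hq1 hx hh1.le).congr fun n => (e5 n).symm, ?_, ?_⟩
  · simpa only [neg_mul] using summable_qPoch_div_mul_pow hq1 hx hh1.le
  · simpa only [neg_mul, e3] using summable_double_outer hq1 hx hh1.le
  · simpa only [neg_mul, e3, e5, one_div] using m1
  · simpa only [e4, e5, one_div] using m2

theorem bailey_identity_sqrt_zero (hq0 : q ≠ 0) (hq1 : ‖q‖ < 1) :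
    (Summable fun n : ℕ => q ^ (2 * n * (n + 1)) / qPoch (-q) (q ^ 2) (n + 1)) ∧
      (∀ n : ℕ, Summable fun k : ℕ =>
        q ^ (2 * (n + 1) * k) / qPoch (-q) (q ^ 2) (k + 1)) ∧
      (Summable fun n : ℕ => (-1) ^ n * q ^ (n * (2 * n + 3)) /
          (qPoch (-q) (q ^ 2) (n + 1) * qPoch (q ^ 2) (q ^ 2) n) *
        ∑' k : ℕ, q ^ (2 * (n + 1) * k) / qPoch (-q) (q ^ 2) (k + 1)) ∧
      (Summable fun n : ℕ => qPoch (-q) (q ^ 2) n * q ^ (n * (n + 2))) ∧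
      1 / qPochInf (-q) (q ^ 2) *
          ∑' n : ℕ, q ^ (2 * n * (n + 1)) / qPoch (-q) (q ^ 2) (n + 1) +
        q *
          ∑' n : ℕ, (-1) ^ n * q ^ (n * (2 * n + 3)) /
              (qPoch (-q) (q ^ 2) (n + 1) * qPoch (q ^ 2) (q ^ 2) n) *
            ∑' k : ℕ, q ^ (2 * (n + 1) * k) / qPoch (-q) (q ^ 2) (k + 1) =
        1 / qPochInf (-q) (q ^ 2) *
          ∑' n : ℕ, qPoch (-q) (q ^ 2) n * q ^ (n * (n + 2)) := by
  obtain ⟨s1, s2, s3, -, s5, m1, -⟩ := bailey_identity_sqrt (x := 0) hq0 hq1 rfl (by simp)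
  have e3 : ∀ m : ℕ, (q ^ 2) ^ m = q ^ (2 * m) := fun m => (pow_mul q 2 m).symm
  have e2 : ∀ a b : ℂ, 1 / a * b = b / a := fun a b => by ring
  simp only [neg_zero, zero_mul, qPoch_zero_left, qPochInf_zero_left, mul_one, e3, ← mul_assoc,
    div_one, sub_zero, one_mul] at s1 s2 s3 s5 m1
  simp only [e2 (qPoch _ _ _)] at s2 s3 m1
  exact ⟨s1, s2, s3, s5, m1⟩

theorem bailey_identity_sqrt_neg_one (hq0 : q ≠ 0) (hq1 : ‖q‖ < 1) :
    (Summable fun n : ℕ => q ^ (2 * n * (n + 1)) / qPoch (-q) q (2 * n + 1)) ∧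
      (∀ n : ℕ, Summable fun k : ℕ =>
        qPoch q (q ^ 2) k / qPoch (-q) (q ^ 2) (k + 1) * q ^ (2 * (n + 1) * k)) ∧
      (Summable fun n : ℕ => (-1) ^ n * q ^ (n * (2 * n + 3)) /
          (qPoch (-q) (q ^ 2) (n + 1) * qPoch (q ^ 2) (q ^ 2) n) *
        ∑' k : ℕ, qPoch q (q ^ 2) k / qPoch (-q) (q ^ 2) (k + 1) * q ^ (2 * (n + 1) * k)) ∧
      (Summable fun n : ℕ =>
        qPoch (-q) (q ^ 2) n / qPoch (-q ^ 2) (q ^ 2) n * q ^ (n * (n + 2))) ∧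
      qPochInf q (q ^ 2) / qPochInf (-q) (q ^ 2) *
          ∑' n : ℕ, q ^ (2 * n * (n + 1)) / qPoch (-q) q (2 * n + 1) +
        2 * q *
          ∑' n : ℕ, (-1) ^ n * q ^ (n * (2 * n + 3)) /
              (qPoch (-q) (q ^ 2) (n + 1) * qPoch (q ^ 2) (q ^ 2) n) *
            ∑' k : ℕ, qPoch q (q ^ 2) k / qPoch (-q) (q ^ 2) (k + 1) * q ^ (2 * (n + 1) * k) =
        1 / qPochInf (-q) (q ^ 2) *
          ∑' n : ℕ, qPoch (-q) (q ^ 2) n / qPoch (-q ^ 2) (q ^ 2) n * q ^ (n * (n + 2)) := by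
  obtain ⟨s1, s2, s3, -, s5, m1, -⟩ := bailey_identity_sqrt (x := -1) hq0 hq1 rfl (by simp)
  have e3 : ∀ m : ℕ, (q ^ 2) ^ m = q ^ (2 * m) := fun m => (pow_mul q 2 m).symm
  have e1 : ∀ n : ℕ, qPoch (-q) (q ^ 2) (n + 1) * qPoch (-q ^ 2) (q ^ 2) n =
      qPoch (-q) q (2 * n + 1) := by
    intro n
    rw [qPoch_two_mul_add_one, show -q * q = -q ^ 2 by ring]
  have e2 : (1 : ℂ) + 1 = 2 := one_add_one_eq_two
  simp only [neg_neg, neg_mul, one_mul, e3, ← mul_assoc, e1, sub_neg_eq_add, e2]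
    at s1 s2 s3 s5 m1
  exact ⟨s1, s2, s3, s5, m1⟩

theorem bailey_identity_sqrt_neg_sqrt (hq0 : q ≠ 0) (hq1 : ‖q‖ < 1) :
    (Summable fun n : ℕ => q ^ (2 * n * (n + 1)) / qPoch (-q) (q ^ 2) (n + 1) ^ 2) ∧
      (∀ n : ℕ, Summable fun k : ℕ =>
        qPoch (q ^ 2) (q ^ 2) k / qPoch (-q) (q ^ 2) (k + 1) * q ^ (2 * (n + 1) * k)) ∧
      (Summable fun n : ℕ => (-1) ^ n * q ^ (n * (2 * n + 3)) /
          (qPoch (-q) (q ^ 2) (n + 1) * qPoch (q ^ 2) (q ^ 2) n) *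
        ∑' k : ℕ, qPoch (q ^ 2) (q ^ 2) k / qPoch (-q) (q ^ 2) (k + 1) *
          q ^ (2 * (n + 1) * k)) ∧
      (Summable fun n : ℕ => q ^ (n * (n + 2)) / (1 + q ^ (2 * n + 1))) ∧
      qPochInf (q ^ 2) (q ^ 2) / qPochInf (-q) (q ^ 2) *
          ∑' n : ℕ, q ^ (2 * n * (n + 1)) / qPoch (-q) (q ^ 2) (n + 1) ^ 2 +
        q *
          ∑' n : ℕ, (-1) ^ n * q ^ (n * (2 * n + 3)) /
              (qPoch (-q) (q ^ 2) (n + 1) * qPoch (q ^ 2) (q ^ 2) n) *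
            ∑' k : ℕ, qPoch (q ^ 2) (q ^ 2) k / qPoch (-q) (q ^ 2) (k + 1) *
              q ^ (2 * (n + 1) * k) =
        1 / qPochInf (-q) (q ^ 2) *
          ∑' n : ℕ, q ^ (n * (n + 2)) / (1 + q ^ (2 * n + 1)) := by
  have hq := one_add_ne_zero_of_norm_lt_one hq1
  obtain ⟨s1, s2, s3, -, s5, m1, -⟩ := bailey_identity_sqrt (x := -q) hq0 hq1 rfl
    (by simpa using hq1.le)
  have e1 : ∀ n : ℕ, q ^ (2 * n * (n + 1)) / qPoch (-q) (q ^ 2) (n + 1) ^ 2 = (1 + q)⁻¹ *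
      ((q ^ 2) ^ (n * (n + 1)) /
        (qPoch (-q) (q ^ 2) (n + 1) * qPoch (-q * q ^ 2) (q ^ 2) n)) := by
    intro n
    rw [sq (qPoch _ _ _)]
    nth_rw 2 [qPoch_succ']
    rw [← pow_mul, sub_neg_eq_add, mul_assoc 2]
    simp only [div_eq_mul_inv, mul_inv]
    ring
  -- The two products are shifted by one factor, so their quotient reduces to (1 + q) / (1 +
  -- q^(2n+1)).
  have e5 : ∀ n : ℕ, q ^ (n * (n + 2)) / (1 + q ^ (2 * n + 1)) = (1 + q)⁻¹ *
      (qPoch (-q) (q ^ 2) n / qPoch (-q * q ^ 2) (q ^ 2) n * q ^ (n * (n + 2))) := by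
    intro n
    have hn := qPoch_neg_ne_zero (norm_sq_lt_one hq1) hq1.le hq (n + 1)
    have h1 : qPoch (-q) (q ^ 2) (n + 1) = qPoch (-q) (q ^ 2) n * (1 + q ^ (2 * n + 1)) := by
      rw [qPoch_succ]; ring
    have h2 : qPoch (-q) (q ^ 2) (n + 1) = (1 + q) * qPoch (-q * q ^ 2) (q ^ 2) n := by
      rw [qPoch_succ', sub_neg_eq_add]
    have h3 := right_ne_zero_of_mul (h2 ▸ hn)
    have h4 := right_ne_zero_of_mul (h1 ▸ hn)
    have h5 := h1.symm.trans h2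
    generalize qPoch (-q * q ^ 2) (q ^ 2) n = a at *
    generalize 1 + q ^ (2 * n + 1) = d at *
    field_simp
    linear_combination (norm := ring_nf) -h5
  have e3 : ∀ m : ℕ, (q ^ 2) ^ m = q ^ (2 * m) := fun m => (pow_mul q 2 m).symm
  have e2 : - -q * q = q ^ 2 := by ring
  refine ⟨(s1.mul_left _).congr fun n => (e1 n).symm, ?_, ?_,
    (s5.mul_left _).congr fun n => (e5 n).symm, ?_⟩
  · simpa only [e2, e3, ← mul_assoc] using s2
  · simpa only [e2, e3, ← mul_assoc] using s3
  · rw [tsum_congr e1, tsum_congr e5, tsum_mul_left, tsum_mul_left, mul_left_comm _ (1 + q)⁻¹,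
      mul_left_comm _ (1 + q)⁻¹, ← m1]
    simp only [e2, e3, ← mul_assoc, sub_neg_eq_add]
    generalize (∑' n : ℕ, (-1) ^ n * q ^ (n * (2 * n + 3)) /
              (qPoch (-q) (q ^ 2) (n + 1) * qPoch (q ^ 2) (q ^ 2) n) *
            ∑' k : ℕ, qPoch (q ^ 2) (q ^ 2) k / qPoch (-q) (q ^ 2) (k + 1) *
              q ^ (2 * (n + 1) * k)) = S
    field_simp

/-- The ratio (x)_(n+1) / (xq)_n equals 1 - x for every n; the constant is moved inside the outer
series. -/
theorem bailey_identity_sqrt_of_qPoch_succ {h : ℂ} (hh0 : h ≠ 0) (hh1 : ‖h‖ < 1) (hh : h ^ 2 = q)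
    {x : ℂ} (hx : ‖x‖ ≤ 1) :
      (Summable fun n : ℕ => q ^ (n * (n + 1)) / (qPoch (-h) q (n + 1) * qPoch (x * q) q n)) ∧
      (∀ n : ℕ, Summable fun k : ℕ =>
        qPoch (-x * h) q k / qPoch (-h) q (k + 1) * q ^ ((n + 1) * k)) ∧
      (Summable fun n : ℕ =>
        qPoch x q (n + 1) / (qPoch (-h) q (n + 1) * qPoch q q n * qPoch (x * q) q n) *
          (-1) ^ n * h ^ (n * (2 * n + 3)) *
            ∑' k : ℕ, qPoch (-x * h) q k / qPoch (-h) q (k + 1) * q ^ ((n + 1) * k)) ∧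
      (Summable fun n : ℕ => h ^ (n ^ 2 + 2 * n) * andrewsA 1 q x n / (1 + h ^ (2 * n + 1))) ∧
      (Summable fun n : ℕ => qPoch (-h) q n / qPoch (x * q) q n * h ^ (n * (n + 2))) ∧
      qPochInf (-x * h) q / qPochInf (-h) q *
          ∑' n : ℕ, q ^ (n * (n + 1)) / (qPoch (-h) q (n + 1) * qPoch (x * q) q n) +
        h *
          ∑' n : ℕ,
            qPoch x q (n + 1) / (qPoch (-h) q (n + 1) * qPoch q q n * qPoch (x * q) q n) *
              (-1) ^ n * h ^ (n * (2 * n + 3)) *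
                ∑' k : ℕ, qPoch (-x * h) q k / qPoch (-h) q (k + 1) * q ^ ((n + 1) * k) =
        1 / qPochInf (q ^ 2) q *
          ∑' n : ℕ, h ^ (n ^ 2 + 2 * n) * andrewsA 1 q x n / (1 + h ^ (2 * n + 1)) ∧
      1 / qPochInf (q ^ 2) q *
          ∑' n : ℕ, h ^ (n ^ 2 + 2 * n) * andrewsA 1 q x n / (1 + h ^ (2 * n + 1)) =
        1 / qPochInf (-h) q *
          ∑' n : ℕ, qPoch (-h) q n / qPoch (x * q) q n * h ^ (n * (n + 2)) := by
  obtain ⟨s1, s2, s3, s4, s5, m1, m2⟩ := bailey_identity_sqrt hh0 hh1 hh hx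
  have hq1 : ‖q‖ < 1 := hh ▸ norm_sq_lt_one hh1
  have e : ∀ (n : ℕ) (S : ℂ),
      qPoch x q (n + 1) / (qPoch (-h) q (n + 1) * qPoch q q n * qPoch (x * q) q n) *
              (-1) ^ n * h ^ (n * (2 * n + 3)) * S =
      (1 - x) * ((-1) ^ n * h ^ (n * (2 * n + 3)) / (qPoch (-h) q (n + 1) * qPoch q q n) * S) := by
    intro n S
    have := qPoch_mul_ne_zero hq1 hx n
    rw [qPoch_succ' x]
    field_simp
  refine ⟨s1, s2, (s3.mul_left (1 - x)).congr fun n => (e n _).symm, s4, s5, ?_, m2⟩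
  rw [m2, ← m1, tsum_congr fun n => e n _, tsum_mul_left]
  ring

end Identities
-- Assembly; the real parameter enters only through |x| ≤ 1
theorem theorem3p2 (q : ℂ) (hq0 : q ≠ 0) (hq1 : ‖q‖ < 1) :
    -- identity 1
    (∀ x : ℝ, -1 ≤ x → x ≤ 1 →
      (Summable fun n : ℕ => q ^ (n * (n + 1)) / (qPoch (-q) q n * qPoch (x * q) q n)) ∧
      (∀ n : ℕ, Summable fun k : ℕ =>
        qPoch (-x) q k / qPoch (-q) q k * q ^ ((n + 1) * k)) ∧
      (Summable fun n : ℕ => (-1) ^ n * q ^ (n * (n + 1)) / qPoch (q ^ 2) (q ^ 2) n *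
        ∑' k : ℕ, qPoch (-x) q k / qPoch (-q) q k * q ^ ((n + 1) * k)) ∧
      (Summable fun n : ℕ => q ^ (n * (n + 1) / 2) * andrewsA 1 q x n) ∧
      (Summable fun n : ℕ => qPoch (-q) q n / qPoch (x * q) q n * q ^ (n * (n + 1) / 2)) ∧
      1 / 2 * (qPochInf (-x) q / qPochInf (-q) q) *
          ∑' n : ℕ, q ^ (n * (n + 1)) / (qPoch (-q) q n * qPoch (x * q) q n) +
        (1 - x) * (1 / 2) *
          ∑' n : ℕ, (-1) ^ n * q ^ (n * (n + 1)) / qPoch (q ^ 2) (q ^ 2) n *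
            ∑' k : ℕ, qPoch (-x) q k / qPoch (-q) q k * q ^ ((n + 1) * k) =
        1 / qPochInf (q ^ 2) q * ∑' n : ℕ, q ^ (n * (n + 1) / 2) * andrewsA 1 q x n ∧
      1 / qPochInf (q ^ 2) q * ∑' n : ℕ, q ^ (n * (n + 1) / 2) * andrewsA 1 q x n =
        1 / qPochInf (-q) q *
          ∑' n : ℕ, qPoch (-q) q n / qPoch (x * q) q n * q ^ (n * (n + 1) / 2)) ∧
    -- identity 2
    ((Summable fun n : ℕ => q ^ (n * (n + 1)) / qPoch (-q) q n) ∧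
      (Summable fun n : ℕ => q ^ n * qPochInf (q ^ (n + 2)) (q ^ 2) / qPoch (-q) q n) ∧
      (Summable fun n : ℕ => qPoch (-q) q n * q ^ (n * (n + 1) / 2)) ∧
      1 / (2 * qPochInf (-q) q) * ∑' n : ℕ, q ^ (n * (n + 1)) / qPoch (-q) q n +
        1 / 2 * ∑' n : ℕ, q ^ n * qPochInf (q ^ (n + 2)) (q ^ 2) / qPoch (-q) q n =
        1 / qPochInf (-q) q * ∑' n : ℕ, qPoch (-q) q n * q ^ (n * (n + 1) / 2)) ∧
    -- identity 3
    ((Summable fun n : ℕ => q ^ (2 * n * (n + 1)) / qPoch (-q) q (2 * n + 1)) ∧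
      (∀ n : ℕ, Summable fun k : ℕ =>
        qPoch q (q ^ 2) k / qPoch (-q ^ 2) (q ^ 2) k * q ^ (2 * (n + 1) * k)) ∧
      (Summable fun n : ℕ => (-1) ^ n * q ^ (2 * n * (n + 1)) / qPoch (q ^ 4) (q ^ 4) n *
        ∑' k : ℕ, qPoch q (q ^ 2) k / qPoch (-q ^ 2) (q ^ 2) k * q ^ (2 * (n + 1) * k)) ∧
      (Summable fun n : ℕ =>
        qPoch (-q ^ 2) (q ^ 2) n / qPoch (-q) (q ^ 2) (n + 1) * q ^ (n * (n + 1))) ∧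
      1 / 2 * (qPochInf q (q ^ 2) / qPochInf (-q ^ 2) (q ^ 2)) *
          ∑' n : ℕ, q ^ (2 * n * (n + 1)) / qPoch (-q) q (2 * n + 1) +
        1 / 2 *
          ∑' n : ℕ, (-1) ^ n * q ^ (2 * n * (n + 1)) / qPoch (q ^ 4) (q ^ 4) n *
            ∑' k : ℕ, qPoch q (q ^ 2) k / qPoch (-q ^ 2) (q ^ 2) k * q ^ (2 * (n + 1) * k) =
        1 / qPochInf (-q ^ 2) (q ^ 2) *
          ∑' n : ℕ,
            qPoch (-q ^ 2) (q ^ 2) n / qPoch (-q) (q ^ 2) (n + 1) * q ^ (n * (n + 1))) ∧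
    -- identity 4, where `h` is a value of `q ^ (1 / 2)`
    (∀ h : ℂ, h ^ 2 = q → ∀ x : ℝ, -1 ≤ x → x ≤ 1 →
      (Summable fun n : ℕ => q ^ (n * (n + 1)) / (qPoch (-h) q (n + 1) * qPoch (x * q) q n)) ∧
      (∀ n : ℕ, Summable fun k : ℕ =>
        qPoch (-x * h) q k / qPoch (-h) q (k + 1) * q ^ ((n + 1) * k)) ∧
      (Summable fun n : ℕ =>
        qPoch x q (n + 1) / (qPoch (-h) q (n + 1) * qPoch q q n * qPoch (x * q) q n) *
          (-1) ^ n * h ^ (n * (2 * n + 3)) *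
            ∑' k : ℕ, qPoch (-x * h) q k / qPoch (-h) q (k + 1) * q ^ ((n + 1) * k)) ∧
      (Summable fun n : ℕ => h ^ (n ^ 2 + 2 * n) * andrewsA 1 q x n / (1 + h ^ (2 * n + 1))) ∧
      (Summable fun n : ℕ => qPoch (-h) q n / qPoch (x * q) q n * h ^ (n * (n + 2))) ∧
      qPochInf (-x * h) q / qPochInf (-h) q *
          ∑' n : ℕ, q ^ (n * (n + 1)) / (qPoch (-h) q (n + 1) * qPoch (x * q) q n) +
        h *
          ∑' n : ℕ,
            qPoch x q (n + 1) / (qPoch (-h) q (n + 1) * qPoch q q n * qPoch (x * q) q n) *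
              (-1) ^ n * h ^ (n * (2 * n + 3)) *
                ∑' k : ℕ, qPoch (-x * h) q k / qPoch (-h) q (k + 1) * q ^ ((n + 1) * k) =
        1 / qPochInf (q ^ 2) q *
          ∑' n : ℕ, h ^ (n ^ 2 + 2 * n) * andrewsA 1 q x n / (1 + h ^ (2 * n + 1)) ∧
      1 / qPochInf (q ^ 2) q *
          ∑' n : ℕ, h ^ (n ^ 2 + 2 * n) * andrewsA 1 q x n / (1 + h ^ (2 * n + 1)) =
        1 / qPochInf (-h) q *
          ∑' n : ℕ, qPoch (-h) q n / qPoch (x * q) q n * h ^ (n * (n + 2))) ∧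
    -- identity 5
    ((Summable fun n : ℕ => q ^ (2 * n * (n + 1)) / qPoch (-q) (q ^ 2) (n + 1)) ∧
      (∀ n : ℕ, Summable fun k : ℕ =>
        q ^ (2 * (n + 1) * k) / qPoch (-q) (q ^ 2) (k + 1)) ∧
      (Summable fun n : ℕ => (-1) ^ n * q ^ (n * (2 * n + 3)) /
          (qPoch (-q) (q ^ 2) (n + 1) * qPoch (q ^ 2) (q ^ 2) n) *
        ∑' k : ℕ, q ^ (2 * (n + 1) * k) / qPoch (-q) (q ^ 2) (k + 1)) ∧
      (Summable fun n : ℕ => qPoch (-q) (q ^ 2) n * q ^ (n * (n + 2))) ∧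
      1 / qPochInf (-q) (q ^ 2) *
          ∑' n : ℕ, q ^ (2 * n * (n + 1)) / qPoch (-q) (q ^ 2) (n + 1) +
        q *
          ∑' n : ℕ, (-1) ^ n * q ^ (n * (2 * n + 3)) /
              (qPoch (-q) (q ^ 2) (n + 1) * qPoch (q ^ 2) (q ^ 2) n) *
            ∑' k : ℕ, q ^ (2 * (n + 1) * k) / qPoch (-q) (q ^ 2) (k + 1) =
        1 / qPochInf (-q) (q ^ 2) *
          ∑' n : ℕ, qPoch (-q) (q ^ 2) n * q ^ (n * (n + 2))) ∧
    -- identity 6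
    ((Summable fun n : ℕ => q ^ (2 * n * (n + 1)) / qPoch (-q) q (2 * n + 1)) ∧
      (∀ n : ℕ, Summable fun k : ℕ =>
        qPoch q (q ^ 2) k / qPoch (-q) (q ^ 2) (k + 1) * q ^ (2 * (n + 1) * k)) ∧
      (Summable fun n : ℕ => (-1) ^ n * q ^ (n * (2 * n + 3)) /
          (qPoch (-q) (q ^ 2) (n + 1) * qPoch (q ^ 2) (q ^ 2) n) *
        ∑' k : ℕ, qPoch q (q ^ 2) k / qPoch (-q) (q ^ 2) (k + 1) * q ^ (2 * (n + 1) * k)) ∧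
      (Summable fun n : ℕ =>
        qPoch (-q) (q ^ 2) n / qPoch (-q ^ 2) (q ^ 2) n * q ^ (n * (n + 2))) ∧
      qPochInf q (q ^ 2) / qPochInf (-q) (q ^ 2) *
          ∑' n : ℕ, q ^ (2 * n * (n + 1)) / qPoch (-q) q (2 * n + 1) +
        2 * q *
          ∑' n : ℕ, (-1) ^ n * q ^ (n * (2 * n + 3)) /
              (qPoch (-q) (q ^ 2) (n + 1) * qPoch (q ^ 2) (q ^ 2) n) *
            ∑' k : ℕ, qPoch q (q ^ 2) k / qPoch (-q) (q ^ 2) (k + 1) * q ^ (2 * (n + 1) * k) =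
        1 / qPochInf (-q) (q ^ 2) *
          ∑' n : ℕ, qPoch (-q) (q ^ 2) n / qPoch (-q ^ 2) (q ^ 2) n * q ^ (n * (n + 2))) ∧
    -- identity 7
    ((Summable fun n : ℕ => q ^ (2 * n * (n + 1)) / qPoch (-q) (q ^ 2) (n + 1) ^ 2) ∧
      (∀ n : ℕ, Summable fun k : ℕ =>
        qPoch (q ^ 2) (q ^ 2) k / qPoch (-q) (q ^ 2) (k + 1) * q ^ (2 * (n + 1) * k)) ∧
      (Summable fun n : ℕ => (-1) ^ n * q ^ (n * (2 * n + 3)) /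
          (qPoch (-q) (q ^ 2) (n + 1) * qPoch (q ^ 2) (q ^ 2) n) *
        ∑' k : ℕ, qPoch (q ^ 2) (q ^ 2) k / qPoch (-q) (q ^ 2) (k + 1) *
          q ^ (2 * (n + 1) * k)) ∧
      (Summable fun n : ℕ => q ^ (n * (n + 2)) / (1 + q ^ (2 * n + 1))) ∧
      qPochInf (q ^ 2) (q ^ 2) / qPochInf (-q) (q ^ 2) *
          ∑' n : ℕ, q ^ (2 * n * (n + 1)) / qPoch (-q) (q ^ 2) (n + 1) ^ 2 +
        q *
          ∑' n : ℕ, (-1) ^ n * q ^ (n * (2 * n + 3)) /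
              (qPoch (-q) (q ^ 2) (n + 1) * qPoch (q ^ 2) (q ^ 2) n) *
            ∑' k : ℕ, qPoch (q ^ 2) (q ^ 2) k / qPoch (-q) (q ^ 2) (k + 1) *
              q ^ (2 * (n + 1) * k) =
        1 / qPochInf (-q) (q ^ 2) *
          ∑' n : ℕ, q ^ (n * (n + 2)) / (1 + q ^ (2 * n + 1))) := by
  have hreal : ∀ x : ℝ, -1 ≤ x → x ≤ 1 → ‖(x : ℂ)‖ ≤ 1 := fun x h1 h2 => by
    rw [Complex.norm_real, Real.norm_eq_abs]
    exact abs_le.2 ⟨h1, h2⟩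
  refine ⟨fun x h1 h2 => bailey_identity_one hq0 hq1 (hreal x h1 h2),
    bailey_identity_one_zero hq0 hq1, bailey_identity_one_neg_sqrt hq0 hq1,
    fun h hh x h1 h2 => bailey_identity_sqrt_of_qPoch_succ ?_ ?_ hh (hreal x h1 h2),
    bailey_identity_sqrt_zero hq0 hq1, bailey_identity_sqrt_neg_one hq0 hq1,
    bailey_identity_sqrt_neg_sqrt hq0 hq1⟩
  · rintro rfl
    exact hq0 (by rw [← hh]; simp)
  · rw [← hh, norm_pow] at hq1
    exact lt_of_pow_lt_pow_left₀ 2 zero_le_one (by simpa using hq1)
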